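/- Let $n\ge 1$ and let $f(z)=\sum_{\alpha\in A}c_\alpha e^{\alpha\cdot z}$ be an exponential polynomial on $\mathbb C^n$ ($A\subset\mathbb Z^n$ finite, $c_\alpha\in\mathbb C\setminus\{0\}$) whose Newton polytope $\Delta_f=\mathrm{conv}\,A\subset\mathbb R^n$ is one-dimensional. Let $T_f=dd^c\log|f|$, where $d^c=(\partial-\bar\partial)/2\pi i$, i.e. $\int T_f\wedge\xi=\int\log|f|\,dd^c\xi$ for test forms $\xi$ (smooth, compactly supported forms of bidegree $(n-1,n-1)$ on $\mathbb C^n$). Write $z=x+iy$, let $\mathbb B^k(0,R)$ be the ball of radius $R$ in $\mathbb R^k$ centred at $0$, $\mathbb B^k=\mathbb B^k(0,1)$, and $\kappa^{n-1}(R)=\mathrm{Vol}_{n-1}(\mathbb B^{n-1}(0,R))$. Then: 1. There are $\alpha_0,\beta\in\mathbb Z^n$, $\beta\ne0$, and a polynomial $P(w)=\sum_{j=0}^{\ell}c_jw^{k_j}$ with integers $0=k_0<k_1<\dots<k_\ell$, such that $A=\{\alpha_0,\alpha_0+k_1\beta,\dots,\alpha_0+k_\ell\beta\}$ and $c_j=c_{\alpha_0+k_j\beta}$.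 2. For all such $\alpha_0,\beta,P$ one has $f(z)=e^{\alpha_0\cdot z}P(e^{\beta\cdot z})$. Let $a_j$ be the distinct zeros of $P$ (they are nonzero) and $d_j$ their multiplicities. For every test form $\xi$ the integrals below converge absolutely, the limits exist, and $$\lim_{R\to\infty}\frac1{\kappa^{n-1}(R)}\int_{|r|<R}\int_z T_f(z)\wedge\xi(z-r)\,dr=\sum_jd_j\int_{\beta\cdot y=\arg a_j}\xi(x+iy)\wedge\frac{\beta\cdot dx}{|\beta|},$$ where $r\in\mathbb R^n$, $\arg$ is multivalued (so $\{\beta\cdot y=\arg a_j\}$ is a union of parallel real hyperplanes of $\mathbb C^n$), and these hyperplanes are oriented so that $\xi\mapsto\int_{\beta\cdot y=\arg a_j}\xi\wedge(\beta\cdot dx)$ is a positive current. That is, the averaged translates of $T_f$ converge to the current $\sum_jd_j\,\frac{\beta\cdot dx}{|\beta|}\wedge[\beta\cdot y=\arg a_j]$. 3. Let moreover $S$ be such that $|x|<S$ for every $x+iy$ in the support of $\xi$, let $C$ be a measurable cone (a set closed under multiplication by positive reals) in the subspace $\{x\in\mathbb R^n:x\cdot\beta=0\}$, let $L^M=\{\lambda\beta:|\lambda|\le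 M/|\beta|\}$ and let $D^M=L^M+C$ be the Minkowski sum. If $M>\frac{|\log|a_j||}{|\beta|}+S$ for all $j$, then $$\lim_{R\to\infty}\frac1{\kappa^{n-1}(R)}\int_{|r|<R,\ r\in D^M}\int_z T_f(z)\wedge\xi(z-r)\,dr=\frac{\mathrm{Vol}_{n-1}(C\cap\mathbb B^{n-1})}{\mathrm{Vol}_{n-1}(\mathbb B^{n-1})}\sum_jd_j\int_{\beta\cdot y=\arg a_j}\xi(x+iy)\wedge\frac{\beta\cdot dx}{|\beta|},$$ where $C\cap\mathbb B^{n-1}$ is the intersection of $C$ with the unit ball. -/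

import Mathlib

open MeasureTheory Filter Topology
open scoped Pointwise ContDiff Polynomial

namespace Coamoeba

noncomputable section

/-! ### Exponential polynomials and their Newton polytopes -/

/-- The space `ℂⁿ` with its Euclidean (Hermitian) norm. -/
abbrev Cn (n : ℕ) := EuclideanSpace ℂ (Fin n)

/-- The space `ℝⁿ` with its Euclidean norm. -/
abbrev Rn (n : ℕ) := EuclideanSpace ℝ (Fin n)

/-- An integer vector, seen in `ℝⁿ`. -/
def intPt {n : ℕ} (α : Fin n → ℤ) : Rn n := WithLp.toLp 2 fun j => (α j : ℝ)

/-- A real vector, seen in `ℂⁿ`. -/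
def realPt {n : ℕ} (r : Rn n) : Cn n := WithLp.toLp 2 fun j => ((r j : ℝ) : ℂ)

/-- The real part `x ∈ ℝⁿ` of `z = x + iy ∈ ℂⁿ`. -/
def rePart {n : ℕ} (z : Cn n) : Rn n := WithLp.toLp 2 fun j => (z j).re

/-- The complex bilinear product `α · z = ∑ⱼ αⱼ zⱼ` of an integer vector and `z ∈ ℂⁿ`. -/
def dotC {n : ℕ} (α : Fin n → ℤ) (z : Cn n) : ℂ := ∑ j, (α j : ℂ) * z j

/-- The exponential polynomial `f(z) = ∑_{α ∈ A} c_α e^{α·z}`; `A ⊂ ℤⁿ` is the (finite) support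
of `c`, so that all the `c_α`, `α ∈ A`, are nonzero. -/
def expPoly {n : ℕ} (c : (Fin n → ℤ) →₀ ℂ) (z : Cn n) : ℂ :=
  ∑ α ∈ c.support, c α * Complex.exp (dotC α z)

/-- The Newton polytope of `f = ∑_{α ∈ A} c_α e^{α·z}`: the convex hull of `A` in `ℝⁿ`. -/
def newtonPolytope {n : ℕ} (c : (Fin n → ℤ) →₀ ℂ) : Set (Rn n) :=
  convexHull ℝ (intPt '' (c.support : Set (Fin n → ℤ)))

/-- The dimension of the Newton polytope, i.e. of its affine span. -/
def newtonDim {n : ℕ} (c : (Fin n → ℤ) →₀ ℂ) : ℕ :=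
  Module.finrank ℝ (vectorSpan ℝ (newtonPolytope c))

/-- `α₀, β, P` present the exponential polynomial with coefficients `c` in one-variable form:
`A = {α₀ + k₀β, …, α₀ + k_ℓ β}` with `0 = k₀ < ⋯ < k_ℓ`, where `k₀, …, k_ℓ` are the exponents of
`P(w) = ∑ⱼ cⱼ w^{kⱼ}`, and `cⱼ = c_{α₀ + kⱼβ}`. -/
structure IsOneVariableForm {n : ℕ} (c : (Fin n → ℤ) →₀ ℂ) (α₀ β : Fin n → ℤ) (P : ℂ[X]) :
    Prop where
  beta_ne_zero : β ≠ 0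
  coeff_zero_ne_zero : P.coeff 0 ≠ 0
  support_eq : c.support = P.support.image fun k : ℕ => α₀ + (k : ℤ) • β
  coeff_eq : ∀ k : ℕ, P.coeff k = c (α₀ + (k : ℤ) • β)

/-! ### Differential forms on `ℂⁿ` -/

/-- Complex valued alternating real `k`-forms on the real vector space underlying `ℂⁿ`. -/
abbrev AltForm (n k : ℕ) := Cn n [⋀^Fin k]→L[ℝ] ℂ

/-- Pullback of a form by the multiplication with the complex number `a`. -/
def mulPullback {n k : ℕ} (a : ℂ) (η : AltForm n k) : AltForm n k :=
  η.compContinuousLinearMap (a • ContinuousLinearMap.id ℝ (Cn n))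

/-- `η` has bidegree `(p, q)`. The pullback of a form of bidegree `(p, q)` by `z ↦ a z` is its
multiple by `a ^ p * conj a ^ q`, and this characterizes the bidegree. -/
def HasBidegree {n k : ℕ} (p q : ℕ) (η : AltForm n k) : Prop :=
  ∀ a : ℂ, mulPullback a η = (a ^ p * (starRingEnd ℂ a) ^ q) • η

/-- The operator `d^c = (∂ - ∂̄) / (2πi)`, written as `(2π)⁻¹ J⁻¹ d J` where `J η = η(i ·, …, i ·)`.
As `J` is the multiplication by `i ^ (p - q)` on forms of bidegree `(p, q)`, one has
`J⁻¹ d J = -i (∂ - ∂̄)`. -/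
def dc {n k : ℕ} (η : Cn n → AltForm n k) (z : Cn n) : AltForm n (k + 1) :=
  ((2 * Real.pi)⁻¹ : ℝ) •
    mulPullback (-Complex.I) (extDeriv (fun z' => mulPullback Complex.I (η z')) z)

/-- The operator `dd^c = (i/π) ∂∂̄`. -/
def ddc {n k : ℕ} (η : Cn n → AltForm n k) : Cn n → AltForm n (k + 1 + 1) :=
  extDeriv (dc η)

/-- The wedge product `η ∧ θ` of a `k`-form with a real `1`-form, written as `(-1)^k θ ∧ η` with
`(θ ∧ η)(v₀, …, v_k) = ∑ᵢ (-1)^i θ(vᵢ) η(v₀, …, v̂ᵢ, …, v_k)`. -/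
def wedgeOne {n k : ℕ} (η : AltForm n k) (θ : Cn n →L[ℝ] ℝ) : AltForm n (k + 1) :=
  ((-1 : ℝ) ^ k) •
    ContinuousAlternatingMap.alternatizeUncurryFin (ContinuousLinearMap.smulRight θ η)

/-- The real `1`-form `(β · dx) / |β|` on `ℂⁿ`, where `x = Re z`. -/
def unitDx {n : ℕ} (β : Fin n → ℤ) : Cn n →L[ℝ] ℝ :=
  ‖intPt β‖⁻¹ • ∑ j, (β j : ℝ) •
    Complex.reCLM.comp ((EuclideanSpace.proj j : Cn n →L[ℂ] ℂ).restrictScalars ℝ)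

/-- The real `1`-form `(β · dy) / |β|` on `ℂⁿ`, where `y = Im z`. -/
def unitDy {n : ℕ} (β : Fin n → ℤ) : Cn n →L[ℝ] ℝ :=
  ‖intPt β‖⁻¹ • ∑ j, (β j : ℝ) •
    Complex.imCLM.comp ((EuclideanSpace.proj j : Cn n →L[ℂ] ℂ).restrictScalars ℝ)

/-- The positively oriented orthonormal frame `e₁, i e₁, …, e_n, i e_n` of `ℂⁿ`, `n = m + 1`. -/
def stdFrame (m : ℕ) (k : Fin (2 * m + 2)) : Cn (m + 1) :=
  EuclideanSpace.single ⟨(k : ℕ) / 2, by omega⟩ (if (k : ℕ) % 2 = 0 then 1 else Complex.I)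

/-- The density of a form of top degree with respect to Lebesgue measure, that is, to
`dx₁ ∧ dy₁ ∧ ⋯ ∧ dx_n ∧ dy_n`. -/
def topCoeff {m : ℕ} (η : AltForm (m + 1) (2 * m + 2)) : ℂ := η (stdFrame m)

/-- `ξ` is a test form of bidegree `(n - 1, n - 1)` on `ℂⁿ`, `n = m + 1`: it is smooth, has compact
support, and has the stated bidegree at each point. -/
structure IsTestForm {m : ℕ} (ξ : Cn (m + 1) → AltForm (m + 1) (2 * m)) : Prop where
  smooth : ContDiff ℝ ∞ ξ
  compact : HasCompactSupport ξ
  bidegree : ∀ z, HasBidegree m m (ξ z)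

/-- The translated form `z ↦ ξ(z - r)`, for `r ∈ ℝⁿ`. -/
def translate {n k : ℕ} (ξ : Cn n → AltForm n k) (r : Rn n) (z : Cn n) : AltForm n k :=
  ξ (z - realPt r)

/-! ### The Lelong current and integration over hyperplanes -/

/-- The density of the form `log|f| dd^c ξ` of top degree. -/
def lelongDensity {m : ℕ} (f : Cn (m + 1) → ℂ) (ξ : Cn (m + 1) → AltForm (m + 1) (2 * m))
    (z : Cn (m + 1)) : ℂ :=
  (Real.log ‖f z‖ : ℂ) * topCoeff (ddc ξ z)

/-- The Lelong current `T_f = dd^c log|f|` on a test form: `∫ T_f ∧ ξ = ∫ log|f| dd^c ξ`. -/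
def lelong {m : ℕ} (f : Cn (m + 1) → ℂ) (ξ : Cn (m + 1) → AltForm (m + 1) (2 * m)) : ℂ :=
  ∫ z, lelongDensity f ξ z

/-- The real hypersurface `{β · y = arg a}` of `ℂⁿ`, with `arg` multivalued. -/
def argHypersurface {n : ℕ} (β : Fin n → ℤ) (a : ℂ) : Set (Cn n) :=
  {z | ∃ k : ℤ, ∑ j, (β j : ℝ) * (z j).im = a.arg + 2 * Real.pi * k}

/-- The density, with respect to the surface measure of the hypersurfaces `{β · y = const}`, of the
restriction of a `(2n - 1)`-form `η` to such a hypersurface. The orientation is the one for which a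
tangent frame `(v₁, …, v_{2n-1})` is positive if and only if `(v₁, …, v_{2n-1}, iβ)` is a positive
frame of `ℂⁿ`: if the `vⱼ` are orthonormal, then `η(v₁, …, v_{2n-1})` is the value of
`η ∧ (β · dy) / |β|` on this frame completed by `iβ / |β|`. For instance
`(u₁, i u₁, …, u_{n-1}, i u_{n-1}, β)` is positive for each complex basis `u` of `{β · z = 0}`,
so that `ξ ∧ (β · dx)` has a nonnegative density for each positive `(n - 1, n - 1)`-form `ξ`. -/
def surfaceDensity {m : ℕ} (β : Fin (m + 1) → ℤ) (η : Cn (m + 1) → AltForm (m + 1) (2 * m + 1))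
    (z : Cn (m + 1)) : ℂ :=
  topCoeff (wedgeOne (η z) (unitDy β))

/-- The integral of a `(2n - 1)`-form over the oriented real hypersurface `{β · y = arg a}`; the
measure is the `(2n - 1)`-dimensional Euclidean surface measure. -/
def surfaceIntegral {m : ℕ} (β : Fin (m + 1) → ℤ) (a : ℂ)
    (η : Cn (m + 1) → AltForm (m + 1) (2 * m + 1)) : ℂ :=
  ∫ z in argHypersurface β a, surfaceDensity β η z ∂(Measure.euclideanHausdorffMeasure (2 * m + 1))

/-- The form `ξ ∧ (β · dx) / |β|`. -/
def wedgeDx {m : ℕ} (β : Fin (m + 1) → ℤ) (ξ : Cn (m + 1) → AltForm (m + 1) (2 * m))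
    (z : Cn (m + 1)) : AltForm (m + 1) (2 * m + 1) :=
  wedgeOne (ξ z) (unitDx β)

/-- The action on `ξ` of the current `∑ⱼ dⱼ (β · dx / |β|) ∧ [β · y = arg aⱼ]`, where the `aⱼ` are
the distinct zeros of `P` and the `dⱼ` their multiplicities. -/
def shellPairing {m : ℕ} (β : Fin (m + 1) → ℤ) (P : ℂ[X])
    (ξ : Cn (m + 1) → AltForm (m + 1) (2 * m)) : ℂ :=
  ∑ a ∈ P.roots.toFinset, (P.rootMultiplicity a : ℂ) * surfaceIntegral β a (wedgeDx β ξ)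

/-! ### Volumes, cones and slabs -/

/-- `κ^k(R)`, the volume of the ball of radius `R` in `ℝᵏ`. -/
def kappa (k : ℕ) (R : ℝ) : ℝ := volume.real (Metric.ball (0 : Rn k) R)

/-- The `k`-dimensional Euclidean volume of a set in `ℝⁿ`. -/
def vol {n : ℕ} (k : ℕ) (s : Set (Rn n)) : ℝ := (Measure.euclideanHausdorffMeasure k).real s

/-- `C` is a (measurable) cone in the subspace `{x ∈ ℝⁿ; x · β = 0}`. -/
structure IsConeIn {n : ℕ} (β : Fin n → ℤ) (C : Set (Rn n)) : Prop where
  measurable : MeasurableSet C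
  perp : ∀ x ∈ C, inner ℝ x (intPt β) = 0
  smul_mem : ∀ t : ℝ, 0 < t → ∀ x ∈ C, t • x ∈ C

/-- The segment `L^M = {λβ; -M/|β| ≤ λ ≤ M/|β|}`. -/
def segmentL {n : ℕ} (β : Fin n → ℤ) (M : ℝ) : Set (Rn n) :=
  (fun t : ℝ => t • intPt β) '' Set.Icc (-(M / ‖intPt β‖)) (M / ‖intPt β‖)

/-- The average `κ^{n-1}(R)⁻¹ ∫_{|r| < R, r ∈ D} ∫ T_f(z) ∧ ξ(z - r) dr`. -/
def average {m : ℕ} (f : Cn (m + 1) → ℂ) (ξ : Cn (m + 1) → AltForm (m + 1) (2 * m))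
    (D : Set (Rn (m + 1))) (R : ℝ) : ℂ :=
  ((kappa m R)⁻¹ : ℝ) • ∫ r in Metric.ball (0 : Rn (m + 1)) R ∩ D, lelong f (translate ξ r)

end

end Coamoeba

/-! Up to the factor `e^{α₀·z}`, `f` depends on the single complex variable `w = β·z/|β|`. Factoring
`P` gives `log|f| = Re(α₀·z) + const + ∑ dⱼ log|e^{β·z} - aⱼ|`. The affine part is pluriharmonic,
and each logarithm has its Laplacian concentrated at the zeros `w = (log aⱼ + 2πik)/|β|`. Hence
`T_f` is the sum, with multiplicities, of the integration currents over the complex hyperplanes `β·z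
= log aⱼ + 2πik` (`IsOneVariable.lelong_eq`).

Translating `ξ` by a real vector `r` moves these hyperplanes relative to `ξ`. The component of `r`
orthogonal to `β` moves them within themselves, so the pairing is a function `Λ(s)` of the
coordinate `s` of `r` along `β/|β|` alone (`lelong_translate`). This `Λ` is continuous with compact
support. Slicing the ball `|r| < R` at height `s` gives an `(n-1)`-ball of radius `√(R² - s²)`,
whose volume divided by `κ^{n-1}(R)` tends to 1, so by dominated convergence the averages tend to `∫
Λ` (`tendsto_setAverage`). As `s` varies, each complex hyperplane sweeps out the real hyperplane
`β·y = arg aⱼ + 2πk`, so by Fubini `∫ Λ` is the sum of the surface integrals (`shellPairing_eq`).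
For part 3, `M` is so large that the slab `|s| ≤ M` contains the support of `Λ`; the slices are then
those of the cone, and the ratio of volumes appears by homogeneity.

The analytic core is the planar identity `Δ log|e^w - 1| = 2π ∑ₖ δ_{2πik}`. It comes from the
regularization `½ log(|e^w - 1|² + ε²)`: on each period strip the substitution `e^w = 1 + εη` turns
its Laplacian into the fixed kernel `2/(1 + |η|²)²`, of total mass `2π`. The algebraic core is that
integer points on a real line form a cyclic group (`exists_isOneVariableForm`). The differential
forms are handled by evaluating `dd^c ξ` on a unitary frame whose first vector is `β/|β|`, where
only the Laplacian along that vector survives integration (`integral_smul_topCoeff_ddc_eq_lap`). -/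

namespace Coamoeba

noncomputable section

/-! ### Directional derivatives of test functions and integration by parts -/

section LineDeriv

variable {E : Type*} [NormedAddCommGroup E] [NormedSpace ℝ E]

/-- A test function: smooth, with compact support. -/
structure IsTest (φ : E → ℂ) : Prop where
  smooth : ContDiff ℝ ∞ φ
  compact : HasCompactSupport φ

theorem IsTest.lineDeriv_eq {φ : E → ℂ} (hφ : IsTest φ) (v : E) :
    (fun z => lineDeriv ℝ φ z v) = fun z => fderiv ℝ φ z v :=
  funext fun z => ((hφ.smooth.differentiable (by simp)) z).lineDeriv_eq_fderiv

theorem IsTest.hasLineDerivAt {φ : E → ℂ} (hφ : IsTest φ) (z v : E) :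
    HasLineDerivAt ℝ φ (lineDeriv ℝ φ z v) z v :=
  ((hφ.smooth.differentiable (by simp)) z).lineDifferentiableAt.hasLineDerivAt

theorem IsTest.lineDeriv {φ : E → ℂ} (hφ : IsTest φ) (v : E) :
    IsTest fun z => lineDeriv ℝ φ z v := by
  rw [hφ.lineDeriv_eq]
  exact ⟨(hφ.smooth.fderiv_right (m := ∞) (by simp)).clm_apply contDiff_const,
    hφ.compact.fderiv_apply ℝ v⟩

theorem IsTest.continuous {φ : E → ℂ} (hφ : IsTest φ) : Continuous φ := hφ.smooth.continuous

theorem IsTest.add {φ ψ : E → ℂ} (hφ : IsTest φ) (hψ : IsTest ψ) : IsTest fun z => φ z + ψ z :=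
  ⟨hφ.smooth.add hψ.smooth, hφ.compact.add hψ.compact⟩

theorem IsTest.lineDeriv_comm {φ : E → ℂ} (hφ : IsTest φ) (v w z : E) :
    _root_.lineDeriv ℝ (fun z => _root_.lineDeriv ℝ φ z v) z w =
      _root_.lineDeriv ℝ (fun z => _root_.lineDeriv ℝ φ z w) z v := by
  have key : ∀ v w : E, _root_.lineDeriv ℝ (fun z => _root_.lineDeriv ℝ φ z v) z w =
      fderiv ℝ (fderiv ℝ φ) z w v := by
    intro v w
    have hd : DifferentiableAt ℝ (fderiv ℝ φ) z :=
      (hφ.smooth.fderiv_right (m := 1) (by norm_cast)).differentiable (by simp) z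
    rw [((hφ.lineDeriv v).smooth.differentiable (by simp) z).lineDeriv_eq_fderiv,
      hφ.lineDeriv_eq, fderiv_clm_apply hd (differentiableAt_const v)]
    simp
  rw [key, key]
  have : IsSymmSndFDerivAt ℝ φ z :=
    hφ.smooth.contDiffAt.isSymmSndFDerivAt (by simp [minSmoothness_of_isRCLikeNormedField]; norm_cast)
  exact this w v

variable [MeasurableSpace E] [BorelSpace E] {μ : Measure E}

theorem IsTest.integrable_smul {φ : E → ℂ} (hφ : IsTest φ) {u : E → ℝ}
    (hu : LocallyIntegrable u μ) : Integrable (fun z => u z • φ z) μ :=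
  hu.integrable_smul_right_of_hasCompactSupport hφ.continuous hφ.compact

variable [FiniteDimensional ℝ E] [μ.IsAddHaarMeasure]

/-- Integration by parts in the direction `v`. -/
theorem IsTest.integral_smul_lineDeriv {φ : E → ℂ} (hφ : IsTest φ) {u u' : E → ℝ} {v : E}
    (hu : LocallyIntegrable u μ) (hu' : LocallyIntegrable u' μ)
    (h : ∀ z, HasLineDerivAt ℝ u (u' z) z v) :
    ∫ z, u z • _root_.lineDeriv ℝ φ z v ∂μ = -∫ z, u' z • φ z ∂μ :=
  integral_bilinear_hasLineDerivAt_right_eq_neg_left_of_integrable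
    (B := ContinuousLinearMap.lsmul ℝ ℝ) (hφ.integrable_smul hu')
    ((hφ.lineDeriv v).integrable_smul hu) (hφ.integrable_smul hu) (fun z _ => h z)
    (fun z _ => hφ.hasLineDerivAt z v)

/-- A function which is constant in the direction `v` is orthogonal to derivatives in this
direction. -/
theorem IsTest.integral_smul_lineDeriv_eq_zero {φ : E → ℂ} (hφ : IsTest φ) {u : E → ℝ} {v : E}
    (hu : LocallyIntegrable u μ) (h : ∀ z (t : ℝ), u (z + t • v) = u z) :
    ∫ z, u z • _root_.lineDeriv ℝ φ z v ∂μ = 0 := by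
  -- Only the derivative along `v` is needed, so `u` may be singular, as `log|f|` is.
  rw [hφ.integral_smul_lineDeriv (u' := fun _ => 0) hu (locallyIntegrable_const 0)]
  · simp
  · intro z
    simp only [HasLineDerivAt, h]
    exact hasDerivAt_const _ _

end LineDeriv

/-! ### The Laplacian along a complex line -/

section Laplacian

variable {E F : Type*} [NormedAddCommGroup E] [NormedSpace ℂ E] [NormedAddCommGroup F]
  [NormedSpace ℂ F]

/-- The Laplacian along the complex line spanned by `b`. -/
def lap (b : E) (φ : E → ℂ) (z : E) : ℂ :=
  lineDeriv ℝ (fun z => lineDeriv ℝ φ z b) z b +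
    lineDeriv ℝ (fun z => lineDeriv ℝ φ z (Complex.I • b)) z (Complex.I • b)

theorem IsTest.lap {φ : E → ℂ} (hφ : IsTest φ) (b : E) : IsTest (lap b φ) :=
  ((hφ.lineDeriv b).lineDeriv b).add ((hφ.lineDeriv _).lineDeriv _)

theorem lineDeriv_comp_affine (φ : F → ℂ) (z₀ : F) (A : E →L[ℂ] F) (w v : E) :
    lineDeriv ℝ (fun w => φ (z₀ + A w)) w v = lineDeriv ℝ φ (z₀ + A w) (A v) := by
  simp only [lineDeriv, map_add, add_assoc, ← Complex.coe_smul, map_smul]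

theorem lap_comp_affine (φ : F → ℂ) (z₀ : F) (A : E →L[ℂ] F) (b w : E) :
    lap b (fun w => φ (z₀ + A w)) w = lap (A b) φ (z₀ + A w) := by
  simp only [lap, lineDeriv_comp_affine, map_smul]
  congr 1
  · exact lineDeriv_comp_affine (fun z => lineDeriv ℝ φ z (A b)) z₀ A w b
  · rw [← map_smul]
    exact lineDeriv_comp_affine (fun z => lineDeriv ℝ φ z (A (Complex.I • b))) z₀ A w _

theorem lap_smul_real (φ : E → ℂ) (c : ℝ) (b z : E) : lap (c • b) φ z = c ^ 2 • lap b φ z := by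
  have key : ∀ v : E, lineDeriv ℝ (fun z => lineDeriv ℝ φ z (c • v)) z (c • v) =
      c ^ 2 • lineDeriv ℝ (fun z => lineDeriv ℝ φ z v) z v := by
    intro v
    simp only [lineDeriv_smul]
    have : lineDeriv ℝ (fun z => c • lineDeriv ℝ φ z v) z v =
        c • lineDeriv ℝ (fun z => lineDeriv ℝ φ z v) z v := by
      simp only [lineDeriv]
      exact deriv_fun_const_smul_field _ _
    rw [this, smul_smul, sq]
  simp only [lap]
  rw [smul_comm Complex.I c b, key, key, smul_add]

end Laplacian

end

end Coamoeba

namespace Coamoeba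

noncomputable section

/-! ### A smooth regularization of `log |exp w - 1|` -/

theorem _root_.HasDerivAt.congr_fun_deriv {f g : ℝ → ℝ} {f' g' x : ℝ} (h : HasDerivAt f f' x)
    (h1 : ∀ t, g t = f t) (h2 : f' = g') : HasDerivAt g g' x := by
  obtain rfl : g = f := funext h1
  exact h2 ▸ h

theorem normSq_exp_sub_one (w : ℂ) : ‖Complex.exp w - 1‖ ^ 2 =
    Real.exp w.re ^ 2 - 2 * Real.exp w.re * Real.cos w.im + 1 := by
  rw [← Complex.normSq_eq_norm_sq, Complex.normSq_apply]
  simp only [Complex.sub_re, Complex.sub_im, Complex.exp_re, Complex.exp_im, Complex.one_re,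
    Complex.one_im]
  linear_combination (Real.exp w.re) ^ 2 * Real.sin_sq_add_cos_sq w.im

/-- `|exp w - 1|² + ε²`. -/
def regSq (ε : ℝ) (w : ℂ) : ℝ :=
  Real.exp w.re ^ 2 - 2 * Real.exp w.re * Real.cos w.im + 1 + ε ^ 2

theorem regSq_eq (ε : ℝ) (w : ℂ) : regSq ε w = ‖Complex.exp w - 1‖ ^ 2 + ε ^ 2 := by
  rw [normSq_exp_sub_one, regSq]

theorem regSq_pos {ε : ℝ} (hε : 0 < ε) (w : ℂ) : 0 < regSq ε w := by
  rw [regSq_eq]; positivity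

theorem continuous_regSq (ε : ℝ) : Continuous (regSq ε) := by
  unfold regSq; fun_prop

theorem hasDerivAt_regSq_one (ε : ℝ) (w : ℂ) : HasDerivAt (fun t : ℝ => regSq ε (w + t • 1))
    (2 * (Real.exp w.re ^ 2 - Real.exp w.re * Real.cos w.im)) 0 := by
  have h1 : HasDerivAt (fun t : ℝ => Real.exp (w.re + t)) (Real.exp w.re) 0 := by
    simpa using (((hasDerivAt_id (0 : ℝ)).const_add w.re).exp)
  have := (((h1.pow 2).sub (((h1.const_mul 2).mul_const (Real.cos w.im)))).add_const 1).add_const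
    (ε ^ 2)
  refine this.congr_fun_deriv (fun t => ?_) ?_
  · simp [regSq]
  · simp; ring

theorem hasDerivAt_regSq_I (ε : ℝ) (w : ℂ) :
    HasDerivAt (fun t : ℝ => regSq ε (w + t • Complex.I))
    (2 * (Real.exp w.re * Real.sin w.im)) 0 := by
  have h1 : HasDerivAt (fun t : ℝ => Real.cos (w.im + t)) (-Real.sin w.im) 0 := by
    simpa using (((hasDerivAt_id (0 : ℝ)).const_add w.im).cos)
  have := ((h1.const_mul (2 * Real.exp w.re)).const_sub (Real.exp w.re ^ 2)).add_const (1 + ε ^ 2)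
  refine this.congr_fun_deriv (fun t => ?_) ?_
  · simp [regSq]; ring
  · ring

/-- The smooth approximation `½ log (|exp w - 1|² + ε²)` of `log |exp w - 1|`. -/
def regLog (ε : ℝ) (w : ℂ) : ℝ := Real.log (regSq ε w) / 2

theorem continuous_regLog {ε : ℝ} (hε : 0 < ε) : Continuous (regLog ε) :=
  ((continuous_regSq ε).log fun w => (regSq_pos hε w).ne').div_const 2

/-- The Laplacian of `regLog ε`. -/
def regKernel (ε : ℝ) (w : ℂ) : ℝ := 2 * ε ^ 2 * Real.exp w.re ^ 2 / regSq ε w ^ 2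

theorem continuous_regKernel {ε : ℝ} (hε : 0 < ε) : Continuous (regKernel ε) :=
  Continuous.div (by fun_prop) ((continuous_regSq ε).pow 2) fun w => (pow_pos (regSq_pos hε w) 2).ne'

/-- Two integrations by parts in each of the directions `1` and `i`. Since `log|e^w - 1|` is
harmonic off its zeros, the terms of the Laplacian without the factor `ε²` cancel. -/
theorem integral_regLog_smul_lap {ε : ℝ} (hε : 0 < ε) {φ : ℂ → ℂ} (hφ : IsTest φ) :
    ∫ w, regLog ε w • lap 1 φ w = ∫ w, regKernel ε w • φ w := by
  have hne : ∀ w, regSq ε w ≠ 0 := fun w => (regSq_pos hε w).ne'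
  have hc := continuous_regSq ε
  have c0 := (continuous_regLog hε).locallyIntegrable (μ := volume)
  let u1 : ℂ → ℝ := fun w => (Real.exp w.re ^ 2 - Real.exp w.re * Real.cos w.im) / regSq ε w
  let u2 : ℂ → ℝ := fun w => (Real.exp w.re * Real.sin w.im) / regSq ε w
  let u11 : ℂ → ℝ := fun w => ((2 * Real.exp w.re ^ 2 - Real.exp w.re * Real.cos w.im) * regSq ε w -
    (Real.exp w.re ^ 2 - Real.exp w.re * Real.cos w.im) *
      (2 * (Real.exp w.re ^ 2 - Real.exp w.re * Real.cos w.im))) / regSq ε w ^ 2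
  let u22 : ℂ → ℝ := fun w => ((Real.exp w.re * Real.cos w.im) * regSq ε w -
    (Real.exp w.re * Real.sin w.im) * (2 * (Real.exp w.re * Real.sin w.im))) / regSq ε w ^ 2
  have c1 : LocallyIntegrable u1 := (Continuous.div (by fun_prop) hc hne).locallyIntegrable
  have c2 : LocallyIntegrable u2 := (Continuous.div (by fun_prop) hc hne).locallyIntegrable
  have c11 : LocallyIntegrable u11 := (Continuous.div (by fun_prop) (hc.pow 2)
    fun w => pow_ne_zero 2 (hne w)).locallyIntegrable
  have c22 : LocallyIntegrable u22 := (Continuous.div (by fun_prop) (hc.pow 2)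
    fun w => pow_ne_zero 2 (hne w)).locallyIntegrable
  have d1 : ∀ w, HasLineDerivAt ℝ (regLog ε) (u1 w) w 1 := by
    intro w
    have := ((hasDerivAt_regSq_one ε w).log (by simpa using hne w)).div_const 2
    unfold HasLineDerivAt
    refine this.congr_fun_deriv (fun t => rfl) ?_
    simp [u1]; ring
  have d2 : ∀ w, HasLineDerivAt ℝ (regLog ε) (u2 w) w Complex.I := by
    intro w
    have := ((hasDerivAt_regSq_I ε w).log (by simpa using hne w)).div_const 2
    unfold HasLineDerivAt
    refine this.congr_fun_deriv (fun t => rfl) ?_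
    simp [u2]; ring
  have d11 : ∀ w, HasLineDerivAt ℝ u1 (u11 w) w 1 := by
    intro w
    have h1 : HasDerivAt (fun t : ℝ => Real.exp (w.re + t)) (Real.exp w.re) 0 := by
      simpa using (((hasDerivAt_id (0 : ℝ)).const_add w.re).exp)
    have := ((h1.pow 2).sub (h1.mul_const (Real.cos w.im))).div (hasDerivAt_regSq_one ε w)
      (by simpa using hne w)
    unfold HasLineDerivAt
    refine this.congr_fun_deriv (fun t => ?_) ?_
    · simp [u1]
    · simp [u11]; ring
  have d22 : ∀ w, HasLineDerivAt ℝ u2 (u22 w) w Complex.I := by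
    intro w
    have h1 : HasDerivAt (fun t : ℝ => Real.sin (w.im + t)) (Real.cos w.im) 0 := by
      simpa using (((hasDerivAt_id (0 : ℝ)).const_add w.im).sin)
    have := (h1.const_mul (Real.exp w.re)).div (hasDerivAt_regSq_I ε w) (by simpa using hne w)
    unfold HasLineDerivAt
    refine this.congr_fun_deriv (fun t => ?_) ?_
    · simp [u2]
    · simp [u22]
  have hI : (Complex.I • (1 : ℂ)) = Complex.I := by simp
  simp only [lap, hI, smul_add]
  rw [integral_add (((hφ.lineDeriv _).lineDeriv _).integrable_smul c0)
    (((hφ.lineDeriv _).lineDeriv _).integrable_smul c0),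
    (hφ.lineDeriv _).integral_smul_lineDeriv c0 c1 d1, hφ.integral_smul_lineDeriv c1 c11 d11,
    (hφ.lineDeriv _).integral_smul_lineDeriv c0 c2 d2, hφ.integral_smul_lineDeriv c2 c22 d22,
    neg_neg, neg_neg, ← integral_add (hφ.integrable_smul c11) (hφ.integrable_smul c22)]
  refine integral_congr_ae (Eventually.of_forall fun w => ?_)
  simp only [← add_smul]
  congr 1
  simp only [u11, u22, regKernel]
  rw [← add_div]
  congr 1
  simp only [regSq]
  linear_combination (-2 * Real.exp w.re ^ 2) * Real.sin_sq_add_cos_sq w.im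

/-! ### Local integrability of `log |exp w - a|` -/

/-- The zeros of `e^w - a` all lie on one vertical line, so discarding such a line avoids the
singularities and the default value of `log 0`. -/
theorem ae_re_ne (x₀ : ℝ) : ∀ᵐ w : ℂ, w.re ≠ x₀ := by
  have h := Complex.volume_preserving_equiv_real_prod
  have h2 : ∀ᵐ p : ℝ × ℝ, p.1 ≠ x₀ := by
    have : ∀ᵐ x : ℝ, x ≠ x₀ := by simp [ae_iff]
    exact Measure.quasiMeasurePreserving_fst.ae this
  exact h.quasiMeasurePreserving.ae h2

theorem abs_log_le_of_mem_Icc {s t T : ℝ} (hs : 0 < s) (hst : s ≤ t) (htT : t ≤ T) :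
    |Real.log t| ≤ |Real.log s| + |Real.log T| := by
  have h1 := Real.log_le_log hs hst
  have h2 := Real.log_le_log (hs.trans_le hst) htT
  rw [abs_le]
  constructor
  · linarith [neg_abs_le (Real.log s), abs_nonneg (Real.log T)]
  · linarith [le_abs_self (Real.log T), abs_nonneg (Real.log s)]

/-- On a bounded set `|e^x - |a|| ≤ |e^w - a| ≤ e^R + |a|`, and the logarithm of the lower bound
depends on `x = Re w` only. It is the logarithm of the modulus of an analytic function of one real
variable, hence integrable on intervals. -/
theorem locallyIntegrable_log_norm_exp_sub (a : ℂ) :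
    LocallyIntegrable (fun w : ℂ => Real.log ‖Complex.exp w - a‖) := by
  have hmeas : Measurable fun w : ℂ => Real.log ‖Complex.exp w - a‖ := by fun_prop
  have hint : ∀ R : ℝ, IntegrableOn (fun x : ℝ => Real.log ‖Real.exp x - ‖a‖‖) (Set.Icc (-R) R) := by
    intro R
    have : IntervalIntegrable (fun x : ℝ => Real.log ‖Real.exp x - ‖a‖‖) volume (-R) R := by
      apply MeromorphicOn.intervalIntegrable_log_norm
      intro x _
      exact (analyticAt_rexp.sub analyticAt_const).meromorphicAt
    rw [integrableOn_Icc_iff_integrableOn_Ioc]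
    by_cases hR : 0 ≤ R
    · exact (intervalIntegrable_iff_integrableOn_Ioc_of_le (by linarith)).1 this
    · rw [Set.Ioc_eq_empty (by linarith)]; exact integrableOn_empty
  rw [locallyIntegrable_iff]
  intro K hK
  obtain ⟨R, hR⟩ := hK.isBounded.exists_norm_le
  have hsub : K ⊆ Complex.measurableEquivRealProd ⁻¹' (Set.Icc (-R) R ×ˢ Set.Icc (-R) R) := by
    intro w hw
    have h1 := (Complex.abs_re_le_norm w).trans (hR w hw)
    have h2 := (Complex.abs_im_le_norm w).trans (hR w hw)
    exact ⟨abs_le.1 h1, abs_le.1 h2⟩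
  refine IntegrableOn.mono_set ?_ hsub
  have hbound : IntegrableOn (fun w : ℂ => |Real.log ‖Real.exp w.re - ‖a‖‖| +
      |Real.log (Real.exp R + ‖a‖)|)
      (Complex.measurableEquivRealProd ⁻¹' (Set.Icc (-R) R ×ˢ Set.Icc (-R) R)) := by
    have h3 : IntegrableOn (fun p : ℝ × ℝ => |Real.log ‖Real.exp p.1 - ‖a‖‖| +
        |Real.log (Real.exp R + ‖a‖)|) (Set.Icc (-R) R ×ˢ Set.Icc (-R) R) := by
      have h4 : IntegrableOn (fun x : ℝ => |Real.log ‖Real.exp x - ‖a‖‖| +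
        |Real.log (Real.exp R + ‖a‖)|) (Set.Icc (-R) R) :=
        (hint R).norm.add (integrableOn_const (by simp))
      unfold IntegrableOn at h4 ⊢
      rw [Measure.volume_eq_prod, ← Measure.prod_restrict]
      exact h4.comp_fst _
    exact (Complex.volume_preserving_equiv_real_prod.integrableOn_comp_preimage
      Complex.measurableEquivRealProd.measurableEmbedding).2 h3
  refine Integrable.mono' hbound hmeas.aestronglyMeasurable ?_
  have hms : MeasurableSet
      (Complex.measurableEquivRealProd ⁻¹' (Set.Icc (-R) R ×ˢ Set.Icc (-R) R)) :=
    Complex.measurableEquivRealProd.measurable (measurableSet_Icc.prod measurableSet_Icc)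
  filter_upwards [ae_restrict_of_ae (ae_re_ne (Real.log ‖a‖)), ae_restrict_mem hms] with w hw hwm
  have hn : ‖Complex.exp w‖ = Real.exp w.re := Complex.norm_exp w
  have hpos : 0 < ‖Real.exp w.re - ‖a‖‖ := by
    rw [norm_pos_iff, sub_ne_zero]
    intro h
    apply hw
    rw [← h, Real.log_exp]
  have hle : ‖Real.exp w.re - ‖a‖‖ ≤ ‖Complex.exp w - a‖ := by
    rw [← hn, Real.norm_eq_abs]
    exact abs_norm_sub_norm_le _ _
  have hge : ‖Complex.exp w - a‖ ≤ Real.exp R + ‖a‖ := by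
    refine (norm_sub_le _ _).trans ?_
    rw [hn]
    gcongr
    exact hwm.1.2
  exact abs_log_le_of_mem_Icc hpos hle hge

end

end Coamoeba

namespace Coamoeba

noncomputable section

/-! ### The logarithm of `|exp w - a|` as a fundamental solution -/

/-- This mass is the constant of the fundamental solution. In polar coordinates the radial integrand
has the primitive `-(r² + 1)⁻¹`. -/
theorem integral_two_div_one_add_norm_sq : ∫ p : ℂ, 2 / (‖p‖ ^ 2 + 1) ^ 2 = 2 * Real.pi := by
  rw [← Complex.integral_comp_polarCoord_symm]
  have h1 : ∀ p : ℝ × ℝ, p.1 • (2 / (‖Complex.polarCoord.symm p‖ ^ 2 + 1) ^ 2) =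
      (p.1 * (2 / (p.1 ^ 2 + 1) ^ 2)) * 1 := by
    intro p
    simp
  simp_rw [h1, polarCoord_target, Measure.volume_eq_prod]
  rw [setIntegral_prod_mul (fun r : ℝ => r * (2 / (r ^ 2 + 1) ^ 2)) (fun _ : ℝ => (1 : ℝ))]
  have h2 : ∫ r in Set.Ioi (0 : ℝ), r * (2 / (r ^ 2 + 1) ^ 2) = 1 := by
    have := integral_Ioi_of_hasDerivAt_of_nonneg' (a := 0) (l := 0)
      (g := fun r : ℝ => -(r ^ 2 + 1)⁻¹) (g' := fun r : ℝ => r * (2 / (r ^ 2 + 1) ^ 2)) ?_ ?_ ?_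
    · simpa using this
    · intro x _
      have hx : x ^ 2 + 1 ≠ 0 := by positivity
      have := ((((hasDerivAt_id x).pow 2).add_const 1).inv hx).neg
      refine this.congr_fun_deriv (fun t => by simp) ?_
      simp; field_simp
    · intro x hx
      have : (0 : ℝ) < x := hx
      positivity
    · have : Tendsto (fun r : ℝ => (r ^ 2 + 1)) atTop atTop :=
        tendsto_atTop_add_const_right _ _ (tendsto_pow_atTop (by norm_num))
      simpa using this.inv_tendsto_atTop.neg
  rw [h2]
  simp
  rw [max_eq_left (by positivity)]
  ring

theorem integrable_two_div_one_add_norm_sq :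
    Integrable fun p : ℂ => 2 / (‖p‖ ^ 2 + 1) ^ 2 := by
  -- A nonintegrable function has integral 0 by convention, while this one has integral `2π`.
  by_contra h
  have := integral_undef h
  rw [integral_two_div_one_add_norm_sq] at this
  have := Real.pi_pos
  linarith

/-- The strip `-π < Im w ≤ π`. -/
def strip : Set ℂ := {w | w.im ∈ Set.Ioc (-Real.pi) Real.pi}

theorem measurableSet_strip : MeasurableSet strip :=
  Complex.measurable_im measurableSet_Ioc

theorem log_exp_of_mem_strip {w : ℂ} (hw : w ∈ strip) : Complex.log (Complex.exp w) = w :=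
  Complex.log_exp hw.1 hw.2

theorem exp_image_strip : Complex.exp '' strip = {0}ᶜ := by
  ext z
  constructor
  · rintro ⟨w, -, rfl⟩
    exact Complex.exp_ne_zero w
  · intro hz
    exact ⟨Complex.log z, ⟨Complex.neg_pi_lt_log_im z, Complex.log_im_le_pi z⟩, Complex.exp_log hz⟩

/-- The exponential maps the strip bijectively onto `ℂ \ {0}`, with real Jacobian `|e^w|² = e^{2 Re
w}`. -/
theorem setIntegral_strip_comp_exp (g : ℂ → ℂ) :
    ∫ w in strip, Real.exp w.re ^ 2 • g (Complex.exp w) = ∫ z, g z := by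
  have h := integral_image_eq_integral_abs_det_fderiv_smul (volume : Measure ℂ) measurableSet_strip
    (f := Complex.exp) (fun w _ =>
      ((Complex.hasDerivAt_exp w).hasFDerivAt.restrictScalars ℝ).hasFDerivWithinAt)
    (fun x hx y hy hxy => by
      rw [← log_exp_of_mem_strip hx, ← log_exp_of_mem_strip hy, hxy]) g
  rw [exp_image_strip, restrict_compl_singleton] at h
  rw [h]
  refine setIntegral_congr_fun measurableSet_strip fun w _ => ?_
  congr 1
  simp [ContinuousLinearMap.det, LinearMap.det_restrictScalars, Algebra.norm_complex_eq,
    Complex.normSq_eq_norm_sq, Complex.norm_exp]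

/-- The complex number `2πik`. -/
def period (k : ℤ) : ℂ := ((2 * Real.pi * k : ℝ) : ℂ) * Complex.I

@[simp] theorem period_re (k : ℤ) : (period k).re = 0 := by simp [period]

@[simp] theorem period_im (k : ℤ) : (period k).im = 2 * Real.pi * k := by simp [period]

theorem exp_add_period (w : ℂ) (k : ℤ) : Complex.exp (w + period k) = Complex.exp w := by
  rw [Complex.exp_add, show period k = k * (2 * Real.pi * Complex.I) by simp [period]; ring,
    Complex.exp_int_mul_two_pi_mul_I, mul_one]

theorem exists_mem_strip (w : ℂ) : ∃ k : ℤ, w - period k ∈ strip := by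
  obtain ⟨k, hk, -⟩ := existsUnique_add_zsmul_mem_Ioc Real.two_pi_pos w.im (-Real.pi)
  refine ⟨-k, ?_⟩
  have h2 : w.im + k • (2 * Real.pi) = (w - period (-k)).im := by simp; ring
  rw [h2, show -Real.pi + 2 * Real.pi = Real.pi by ring] at hk
  exact hk

theorem strip_disjoint {w : ℂ} {k l : ℤ} (hk : w - period k ∈ strip) (hl : w - period l ∈ strip) :
    k = l := by
  have h1 := log_exp_of_mem_strip hk
  have h2 := log_exp_of_mem_strip hl
  have h3 : ∀ k, Complex.exp (w - period k) = Complex.exp w := fun k => by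
    conv_rhs => rw [← sub_add_cancel w (period k), exp_add_period]
  rw [h3] at h1 h2
  have := congrArg Complex.im (h1.symm.trans h2)
  simp at this
  exact this

/-- The translates of the strip by the periods tile the plane, and those outside `K` do not
contribute. -/
theorem integral_eq_sum_strip {f : ℂ → ℂ} (hf : Integrable f) (K : Finset ℤ)
    (hK : ∀ w, ∀ k ∉ K, w - period k ∈ strip → f w = 0) :
    ∫ w, f w = ∑ k ∈ K, ∫ w in strip, f (w + period k) := by
  let S : ℤ → Set ℂ := fun k => (fun w => w - period k) ⁻¹' strip
  have hS : ∀ k, MeasurableSet (S k) := fun k =>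
    (measurable_sub_const (period k)) measurableSet_strip
  have h1 : ∫ w, f w = ∫ w in ⋃ k ∈ K, S k, f w := by
    rw [setIntegral_eq_integral_of_forall_compl_eq_zero]
    intro w hw
    obtain ⟨k, hk⟩ := exists_mem_strip w
    refine hK w k (fun hkK => hw ?_) hk
    exact Set.mem_biUnion (s := (K : Set ℤ)) hkK hk
  rw [h1, integral_biUnion_finset K (fun k _ => hS k) ?_ (fun k _ => hf.integrableOn)]
  · refine Finset.sum_congr rfl fun k _ => ?_
    have := (measurePreserving_sub_right (volume : Measure ℂ) (period k)).setIntegral_preimage_emb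
      (MeasurableEquiv.subRight (period k)).measurableEmbedding (fun w => f (w + period k)) strip
    simpa [S] using this
  · intro k _ l _ hkl
    exact Set.disjoint_left.2 fun w hk hl => hkl (strip_disjoint hk hl)

/-- The factor `e^{2 Re w}` of the kernel is the Jacobian of `z = e^w`; the further substitution `z
= 1 + εη` removes `ε` from the kernel and leaves it only in the argument of `φ`. -/
theorem setIntegral_strip_regKernel {ε : ℝ} (hε : 0 < ε) (φ : ℂ → ℂ) (k : ℤ) :
    ∫ w in strip, regKernel ε (w + period k) • φ (w + period k) =
      ∫ η : ℂ, (2 / (‖η‖ ^ 2 + 1) ^ 2) • φ (Complex.log (1 + ε • η) + period k) := by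
  let g : ℂ → ℂ := fun z => (2 * ε ^ 2 / (‖z - 1‖ ^ 2 + ε ^ 2) ^ 2) • φ (Complex.log z + period k)
  have h1 : ∫ w in strip, regKernel ε (w + period k) • φ (w + period k) =
      ∫ w in strip, Real.exp w.re ^ 2 • g (Complex.exp w) := by
    refine setIntegral_congr_fun measurableSet_strip fun w hw => ?_
    simp only [g, log_exp_of_mem_strip hw, regKernel, exp_add_period, smul_smul, regSq_eq,
      Complex.add_re, period_re, add_zero]
    congr 1
    ring
  rw [h1, setIntegral_strip_comp_exp, ← integral_add_left_eq_self g 1]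
  have h2 := Measure.integral_comp_smul (volume : Measure ℂ) (fun z => g (1 + z)) ε
  rw [Complex.finrank_real_complex, abs_of_pos (by positivity)] at h2
  have h3 : ∫ z, g (1 + z) = ε ^ 2 • ∫ η : ℂ, g (1 + ε • η) := by
    rw [h2, smul_smul, mul_inv_cancel₀ (by positivity), one_smul]
  rw [h3, ← integral_smul]
  refine integral_congr_ae (Eventually.of_forall fun η => ?_)
  simp only [g, smul_smul]
  congr 1
  rw [add_sub_cancel_left, norm_smul, Real.norm_of_nonneg hε.le]
  field_simp

/-- Dominated convergence, as `log(1 + εη) → 0` for fixed `η` and `φ` is bounded. -/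
theorem tendsto_setIntegral_strip_regKernel {φ : ℂ → ℂ} (hφ : IsTest φ) (k : ℤ) :
    Tendsto (fun ε : ℝ => ∫ w in strip, regKernel ε (w + period k) • φ (w + period k)) (𝓝[>] 0)
      (𝓝 ((2 * Real.pi) • φ (period k))) := by
  have h0 : (2 * Real.pi) • φ (period k) =
      ∫ η : ℂ, (2 / (‖η‖ ^ 2 + 1) ^ 2) • φ (period k) := by
    rw [integral_smul_const, integral_two_div_one_add_norm_sq]
  rw [h0]
  obtain ⟨B, hB⟩ := hφ.continuous.bounded_above_of_compact_support hφ.compact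
  refine Tendsto.congr' (f₁ := fun ε : ℝ =>
      ∫ η : ℂ, (2 / (‖η‖ ^ 2 + 1) ^ 2) • φ (Complex.log (1 + ε • η) + period k)) ?_ ?_
  · filter_upwards [self_mem_nhdsWithin] with ε hε
    exact (setIntegral_strip_regKernel hε φ k).symm
  · refine tendsto_integral_filter_of_dominated_convergence
      (fun η : ℂ => (2 / (‖η‖ ^ 2 + 1) ^ 2) * B) ?_ ?_
      (integrable_two_div_one_add_norm_sq.mul_const B) ?_
    · refine Eventually.of_forall fun ε => Measurable.aestronglyMeasurable ?_
      have := hφ.continuous.measurable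
      have h2 : Measurable fun η : ℂ => Complex.log (1 + ε • η) + period k :=
        (Complex.measurable_log.comp (by fun_prop)).add_const _
      have h3 : Measurable fun η : ℂ => 2 / (‖η‖ ^ 2 + 1) ^ 2 := by fun_prop
      exact h3.smul (this.comp h2)
    · refine Eventually.of_forall fun ε => Eventually.of_forall fun η => ?_
      rw [norm_smul, Real.norm_of_nonneg (by positivity)]
      gcongr
      exact hB _
    · refine Eventually.of_forall fun η => ?_
      have h1 : Tendsto (fun ε : ℝ => 1 + ε • η) (𝓝[>] 0) (𝓝 1) := by
        have : Continuous fun ε : ℝ => 1 + ε • η := by fun_prop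
        simpa using (this.tendsto 0).mono_left nhdsWithin_le_nhds
      have h2 : Tendsto (fun ε : ℝ => Complex.log (1 + ε • η) + period k) (𝓝[>] 0)
          (𝓝 (period k)) := by
        have := (h1.clog (by simp)).add_const (period k)
        simpa using this
      exact ((hφ.continuous.tendsto _).comp h2).const_smul _

/-- For `0 < ε < 1` the regularized square lies between its values at `ε = 0` and `ε = 1`, so its
logarithm is dominated by the sum of the two extreme ones, both locally integrable. -/
theorem tendsto_integral_regLog {φ : ℂ → ℂ} (hφ : IsTest φ) :
    Tendsto (fun ε : ℝ => ∫ w, regLog ε w • φ w) (𝓝[>] 0)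
      (𝓝 (∫ w, Real.log ‖Complex.exp w - 1‖ • φ w)) := by
  have hne : ∀ᵐ w : ℂ, 0 < ‖Complex.exp w - 1‖ := by
    filter_upwards [ae_re_ne 0] with w hw
    rw [norm_pos_iff, sub_ne_zero]
    intro h
    apply hw
    have := congrArg norm h
    simpa [Complex.norm_exp] using this
  have hi1 : Integrable fun w => |Real.log ‖Complex.exp w - 1‖| * ‖φ w‖ := by
    have := (hφ.integrable_smul (locallyIntegrable_log_norm_exp_sub 1)).norm
    simpa [norm_smul] using this
  have hi2 : Integrable fun w => |regLog 1 w| * ‖φ w‖ := by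
    have := (hφ.integrable_smul (μ := volume)
      (continuous_regLog one_pos).locallyIntegrable).norm
    simpa [norm_smul] using this
  refine tendsto_integral_filter_of_dominated_convergence
      (fun w => |Real.log ‖Complex.exp w - 1‖| * ‖φ w‖ + |regLog 1 w| * ‖φ w‖) ?_ ?_
      (hi1.add hi2) ?_
  · filter_upwards [self_mem_nhdsWithin] with ε hε
    exact ((continuous_regLog hε).smul hφ.continuous).aestronglyMeasurable
  · filter_upwards [Ioo_mem_nhdsGT one_pos] with ε hε
    filter_upwards [hne] with w hw
    rw [norm_smul, ← add_mul]
    gcongr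
    have h1 : Real.log ‖Complex.exp w - 1‖ = Real.log (‖Complex.exp w - 1‖ ^ 2) / 2 := by
      rw [Real.log_pow]; push_cast; ring
    rw [h1, regLog, regLog, Real.norm_eq_abs, abs_div, abs_div, abs_div, ← add_div]
    gcongr
    refine abs_log_le_of_mem_Icc (by positivity) ?_ ?_
    · rw [regSq_eq]; nlinarith
    · rw [regSq_eq, regSq_eq]; nlinarith [hε.1, hε.2]
  · filter_upwards [hne] with w hw
    refine Tendsto.smul_const ?_ _
    have h1 : Real.log ‖Complex.exp w - 1‖ = Real.log (‖Complex.exp w - 1‖ ^ 2 + 0 ^ 2) / 2 := by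
      rw [zero_pow two_ne_zero, add_zero, Real.log_pow]; push_cast; ring
    rw [h1]
    simp only [regLog, regSq_eq]
    have h2 : Tendsto (fun ε : ℝ => ‖Complex.exp w - 1‖ ^ 2 + ε ^ 2) (𝓝[>] 0)
        (𝓝 (‖Complex.exp w - 1‖ ^ 2 + 0 ^ 2)) := by
      have : Continuous fun ε : ℝ => ‖Complex.exp w - 1‖ ^ 2 + ε ^ 2 := by fun_prop
      exact (this.tendsto 0).mono_left nhdsWithin_le_nhds
    exact (h2.log (by positivity)).div_const 2

theorem integral_log_norm_exp_sub_one_smul_lap {φ : ℂ → ℂ} (hφ : IsTest φ) (K : Finset ℤ)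
    (hK : ∀ k ∉ K, φ (period k) = 0) :
    ∫ w, Real.log ‖Complex.exp w - 1‖ • lap 1 φ w = (2 * Real.pi) • ∑ k ∈ K, φ (period k) := by
  obtain ⟨B, hB⟩ := hφ.compact.isBounded.exists_norm_le
  obtain ⟨N, hN⟩ := exists_nat_gt B
  classical
  -- `K` controls `φ` at the periods only, but the strip decomposition requires `φ` to vanish on
  -- every omitted strip. The strips that can meet the support have index at most `N` in absolute
  -- value.
  let K' : Finset ℤ := K ∪ Finset.Icc (-(N : ℤ)) N
  have hK' : ∀ w, ∀ k ∉ K', w - period k ∈ strip → φ w = 0 := by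
    intro w k hk hw
    by_contra hne
    apply hk
    refine Finset.mem_union_right _ ?_
    have h1 := (Complex.abs_im_le_norm w).trans (hB w (subset_tsupport _ hne))
    have h2 : -Real.pi < (w - period k).im ∧ (w - period k).im ≤ Real.pi := hw
    simp only [Complex.sub_im, period_im] at h2
    rw [abs_le] at h1
    have hpi := Real.pi_gt_three
    rw [Finset.mem_Icc, ← abs_le]
    by_contra hcon
    have hcon' : (N : ℝ) + 1 ≤ |(k : ℝ)| := by
      have : (N : ℤ) + 1 ≤ |k| := by omega
      exact_mod_cast this
    rcases le_abs.1 hcon' with h | h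
    · nlinarith
    · nlinarith
  have e1 := tendsto_integral_regLog (hφ.lap 1)
  have e2 : Tendsto (fun ε : ℝ => ∫ w, regLog ε w • lap 1 φ w) (𝓝[>] 0)
      (𝓝 (∑ k ∈ K', (2 * Real.pi) • φ (period k))) := by
    refine Tendsto.congr' ?_ (tendsto_finsetSum K' fun k _ =>
      tendsto_setIntegral_strip_regKernel hφ k)
    filter_upwards [self_mem_nhdsWithin] with ε hε
    rw [integral_regLog_smul_lap hε hφ, integral_eq_sum_strip
      (hφ.integrable_smul (continuous_regKernel hε).locallyIntegrable) K']
    intro w k hk hw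
    rw [hK' w k hk hw, smul_zero]
  rw [tendsto_nhds_unique e1 e2, ← Finset.smul_sum]
  congr 1
  refine (Finset.sum_subset Finset.subset_union_left fun k _ hk => hK k hk).symm

/-- The substitution `w = c⁻¹(log a + w')` turns `e^{cw} - a` into `a(e^{w'} - 1)`. The constant
`log|a|` integrates to zero against a Laplacian, and the Jacobian `c⁻²` is exactly the scaling
factor of the Laplacian. -/
theorem integral_log_norm_exp_sub_smul_lap {φ : ℂ → ℂ} (hφ : IsTest φ) {a : ℂ} (ha : a ≠ 0) {c : ℝ}
    (hc : 0 < c) (K : Finset ℤ)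
    (hK : ∀ k ∉ K, φ (c⁻¹ • (Complex.log a + period k)) = 0) :
    ∫ w, Real.log ‖Complex.exp (c • w) - a‖ • lap 1 φ w =
      (2 * Real.pi) • ∑ k ∈ K, φ (c⁻¹ • (Complex.log a + period k)) := by
  let A : ℂ →L[ℂ] ℂ := (c⁻¹ : ℂ) • ContinuousLinearMap.id ℂ ℂ
  have hA : ∀ w, A w = c⁻¹ • w := fun w => by simp [A]
  let ψ : ℂ → ℂ := fun w => φ (c⁻¹ • Complex.log a + A w)
  have hψ : IsTest ψ := by
    refine ⟨hφ.smooth.comp (contDiff_const.add (A.restrictScalars ℝ).contDiff), ?_⟩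
    let e : ℂ ≃ₜ ℂ := (Homeomorph.smulOfNeZero (c⁻¹ : ℝ) (by positivity)).trans
      (Homeomorph.addLeft (c⁻¹ • Complex.log a))
    have := hφ.compact.comp_homeomorph e
    convert this using 1
    ext w
    simp [ψ, e, hA]
  have h1 := integral_log_norm_exp_sub_one_smul_lap hψ K (fun k hk => by
    simp only [ψ, hA, ← smul_add]; exact hK k hk)
  have h2 : ∀ w, lap 1 ψ w = (c⁻¹) ^ 2 • lap 1 φ (c⁻¹ • Complex.log a + A w) := by
    intro w
    rw [lap_comp_affine, hA, lap_smul_real]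
  have hconst : ∀ r : ℝ, ∫ w, r • lap 1 ψ w = 0 := by
    intro r
    have hl : LocallyIntegrable fun _ : ℂ => r := locallyIntegrable_const r
    simp only [lap, smul_add]
    rw [integral_add (((hψ.lineDeriv _).lineDeriv _).integrable_smul hl)
      (((hψ.lineDeriv _).lineDeriv _).integrable_smul hl),
      (hψ.lineDeriv _).integral_smul_lineDeriv_eq_zero hl (by simp),
      (hψ.lineDeriv _).integral_smul_lineDeriv_eq_zero hl (by simp), add_zero]
  have hae : ∀ᵐ w : ℂ, Real.log ‖Complex.exp (c • (c⁻¹ • (Complex.log a + w))) - a‖ =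
      Real.log ‖a‖ + Real.log ‖Complex.exp w - 1‖ := by
    filter_upwards [ae_re_ne 0] with w hw
    have hne : Complex.exp w - 1 ≠ 0 := by
      rw [sub_ne_zero]
      intro h
      apply hw
      have := congrArg norm h
      simpa [Complex.norm_exp] using this
    rw [smul_smul, mul_inv_cancel₀ hc.ne', one_smul, Complex.exp_add, Complex.exp_log ha,
      show a * Complex.exp w - a = a * (Complex.exp w - 1) by ring, norm_mul,
      Real.log_mul (norm_ne_zero_iff.2 ha) (norm_ne_zero_iff.2 hne)]
  let F : ℂ → ℂ := fun w => Real.log ‖Complex.exp (c • w) - a‖ • lap 1 φ w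
  have h3 : ∫ w, F w = (c⁻¹) ^ 2 • ∫ w, F (c⁻¹ • (Complex.log a + w)) := by
    rw [integral_add_left_eq_self (fun w => F (c⁻¹ • w)) (Complex.log a),
      Measure.integral_comp_smul, Complex.finrank_real_complex, abs_of_pos (by positivity),
      smul_smul, mul_inv_cancel₀ (by positivity), one_smul]
  have h4 : ∫ w, (c⁻¹) ^ 2 • F (c⁻¹ • (Complex.log a + w)) =
      ∫ w, (Real.log ‖a‖ • lap 1 ψ w + Real.log ‖Complex.exp w - 1‖ • lap 1 ψ w) := by
    refine integral_congr_ae ?_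
    filter_upwards [hae] with w hw
    simp only [F]
    rw [hw, h2, hA, ← smul_add, ← add_smul, smul_comm]
  change ∫ w, F w = _
  rw [h3, ← integral_smul, h4, integral_add ((hψ.lap 1).integrable_smul (locallyIntegrable_const _))
    ((hψ.lap 1).integrable_smul (locallyIntegrable_log_norm_exp_sub 1)), hconst, zero_add, h1]
  simp only [ψ, hA, smul_add]

end

end Coamoeba

namespace Coamoeba

noncomputable section

/-! ### Top degree forms on unitary frames -/

/-- The real frame `e₀, i e₀, e₁, i e₁, …` of a complex orthonormal basis `e`. -/
def frame {m : ℕ} (e : OrthonormalBasis (Fin (m + 1)) ℂ (Cn (m + 1))) (k : Fin (2 * m + 2)) :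
    Cn (m + 1) :=
  (if (k : ℕ) % 2 = 0 then (1 : ℂ) else Complex.I) • e ⟨(k : ℕ) / 2, by omega⟩

theorem stdFrame_eq_frame (m : ℕ) : stdFrame m = frame (EuclideanSpace.basisFun _ ℂ) := by
  ext k j
  by_cases h : (k : ℕ) % 2 = 0 <;> simp [stdFrame, frame, EuclideanSpace.basisFun_apply, h]

/-- The pairs `(j, 0), (j, 1)` in the order `(0, 0), (0, 1), (1, 0), (1, 1), …`. -/
def frameIndex (m : ℕ) : Fin 2 × Fin (m + 1) ≃ Fin (2 * m + 2) :=
  (Equiv.prodComm _ _).trans (finProdFinEquiv.trans (finCongr (by ring)))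

/-- The real basis underlying the frame of a complex orthonormal basis. -/
def frameBasis {m : ℕ} (e : OrthonormalBasis (Fin (m + 1)) ℂ (Cn (m + 1))) :
    Module.Basis (Fin (2 * m + 2)) ℝ (Cn (m + 1)) :=
  (Complex.basisOneI.smulTower e.toBasis).reindex (frameIndex m)

theorem coe_frameBasis {m : ℕ} (e : OrthonormalBasis (Fin (m + 1)) ℂ (Cn (m + 1))) :
    ⇑(frameBasis e) = frame e := by
  ext1 k
  obtain ⟨⟨i, j⟩, rfl⟩ := (frameIndex m).surjective k
  have h1 : ((frameIndex m (i, j) : Fin (2 * m + 2)) : ℕ) = i + 2 * j := by simp [frameIndex]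
  rw [frameBasis, Module.Basis.reindex_apply, Equiv.symm_apply_apply, Module.Basis.smulTower_apply,
    frame]
  have h2 : (⟨(frameIndex m (i, j) : ℕ) / 2, by omega⟩ : Fin (m + 1)) = j := by
    ext; simp only [h1]; omega
  rw [h2, h1]
  fin_cases i <;> simp [Complex.basisOneI]

/-- A top form is a multiple of the determinant, and a unitary map has real determinant `|det|² =
1`. The density may therefore be computed in a frame adapted to `β`. -/
theorem topCoeff_eq_apply_frame {m : ℕ} (e : OrthonormalBasis (Fin (m + 1)) ℂ (Cn (m + 1)))
    (η : AltForm (m + 1) (2 * m + 2)) : topCoeff η = η (frame e) := by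
  let e₀ := EuclideanSpace.basisFun (Fin (m + 1)) ℂ
  let b := frameBasis e₀
  have hη : η.toAlternatingMap =
      (LinearMap.toSpanSingleton ℝ ℂ (η b)).compAlternatingMap b.det := by
    refine Module.Basis.ext_alternating b fun i h => ?_
    let σ : Equiv.Perm (Fin (2 * m + 2)) :=
      Equiv.ofBijective i (Finite.injective_iff_bijective.1 h)
    change η.toAlternatingMap (b ∘ σ) = LinearMap.toSpanSingleton ℝ ℂ (η b) (b.det (b ∘ σ))
    rw [AlternatingMap.map_perm, AlternatingMap.map_perm, Module.Basis.det_self]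
    rcases Int.units_eq_one_or (Equiv.Perm.sign σ) with h | h <;> rw [h] <;> simp
  let U : Cn (m + 1) →ₗ[ℂ] Cn (m + 1) := (e₀.equiv e (Equiv.refl _)).toLinearEquiv.toLinearMap
  have hU : ∀ j, U (e₀ j) = e j := fun j => by simp [U]
  have hUdet : Complex.normSq (LinearMap.det U) = 1 := by
    have h1 : e₀.toBasis.det (⇑U ∘ ⇑e₀.toBasis) = LinearMap.det U := by
      rw [Module.Basis.det_comp, Module.Basis.det_self, mul_one]
    have h2 : ⇑U ∘ ⇑e₀.toBasis = e := by ext1 j; simp [hU]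
    rw [h2] at h1
    rw [← h1, Complex.normSq_eq_norm_sq, OrthonormalBasis.det_to_matrix_orthonormalBasis, one_pow]
  have hF : frame e = ⇑(U.restrictScalars ℝ) ∘ ⇑b := by
    ext1 k
    simp only [b, coe_frameBasis, Function.comp_apply, frame, LinearMap.restrictScalars_apply,
      map_smul, hU]
  have h3 : b.det (frame e) = 1 := by
    rw [hF, Module.Basis.det_comp, Module.Basis.det_self, LinearMap.det_restrictScalars,
      Algebra.norm_complex_apply, hUdet, one_mul]
  have h4 : η (frame e) = (LinearMap.toSpanSingleton ℝ ℂ (η b)) (b.det (frame e)) :=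
    congrArg (fun f : (Cn (m + 1)) [⋀^Fin (2 * m + 2)]→ₗ[ℝ] ℂ => f (frame e)) hη
  rw [h4, h3, topCoeff, stdFrame_eq_frame, ← coe_frameBasis]
  simp [b, e₀]

/-! ### The operator `dd^c` in terms of directional derivatives -/

theorem mulPullback_apply {n k : ℕ} (a : ℂ) (η : AltForm n k) (v : Fin k → Cn n) :
    mulPullback a η v = η fun i => a • v i := by
  simp only [mulPullback, ContinuousAlternatingMap.compContinuousLinearMap_apply]
  rfl

/-- The scaling factor is `(i · conj i)^m = 1`; this removes the inner `J` from `dc` on forms of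
bidegree `(m, m)`. -/
theorem mulPullback_I_eq {n m : ℕ} {η : AltForm n (2 * m)} (h : HasBidegree m m η) :
    mulPullback Complex.I η = η := by
  rw [h, ← mul_pow]; simp

theorem mulPullback_neg_I_eq {n m : ℕ} {η : AltForm n (2 * m)} (h : HasBidegree m m η) :
    mulPullback (-Complex.I) η = η := by
  rw [h, ← mul_pow]; simp

theorem extDeriv_apply_eq {n k : ℕ} {θ : Cn n → AltForm n k} (hθ : Differentiable ℝ θ) (z : Cn n)
    (v : Fin (k + 1) → Cn n) :
    extDeriv θ z v =
      ∑ i : Fin (k + 1), (-1) ^ (i : ℕ) • lineDeriv ℝ (fun z' => θ z' (i.removeNth v)) z (v i) := by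
  rw [extDeriv, ContinuousAlternatingMap.alternatizeUncurryFin_apply]
  refine Finset.sum_congr rfl fun i _ => ?_
  have := (hθ z).hasFDerivAt.continuousAlternatingMap_apply_const (i.removeNth v)
  rw [(this.hasLineDerivAt (v i)).lineDeriv]
  rfl

variable {m : ℕ} {ξ : Cn (m + 1) → AltForm (m + 1) (2 * m)}

theorem dc_eq (hξ : IsTestForm ξ) (z : Cn (m + 1)) :
    dc ξ z = ((2 * Real.pi)⁻¹ : ℝ) • mulPullback (-Complex.I) (extDeriv ξ z) := by
  have : (fun z' => mulPullback Complex.I (ξ z')) = ξ :=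
    funext fun z' => mulPullback_I_eq (hξ.bidegree z')
  rw [dc, this]

theorem IsTestForm.isTest_apply (hξ : IsTestForm ξ) (v : Fin (2 * m) → Cn (m + 1)) :
    IsTest fun z => ξ z v :=
  ⟨(ContinuousAlternatingMap.apply ℝ (Cn (m + 1)) ℂ v).contDiff.comp hξ.smooth,
    hξ.compact.comp_left (g := fun η : AltForm (m + 1) (2 * m) => η v) rfl⟩

/-- The outer `J⁻¹` acts only on the direction of differentiation: on the other arguments it is
absorbed by the invariance of `(m, m)`-forms. -/
theorem dc_apply (hξ : IsTestForm ξ) (z : Cn (m + 1)) (v : Fin (2 * m + 1) → Cn (m + 1)) :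
    dc ξ z v = ((2 * Real.pi)⁻¹ : ℝ) • ∑ i : Fin (2 * m + 1), (-1) ^ (i : ℕ) •
      lineDeriv ℝ (fun z' => ξ z' (i.removeNth v)) z (-(Complex.I • v i)) := by
  rw [dc_eq hξ, ContinuousAlternatingMap.smul_apply, mulPullback_apply,
    extDeriv_apply_eq (hξ.smooth.differentiable (by simp))]
  congr 1
  refine Finset.sum_congr rfl fun i _ => ?_
  rw [neg_smul]
  congr 2
  ext z'
  have := congrArg (fun η => η (i.removeNth v)) (mulPullback_neg_I_eq (hξ.bidegree z'))
  simp only [mulPullback_apply] at this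
  exact this

theorem differentiable_dc (hξ : IsTestForm ξ) : Differentiable ℝ (dc ξ) := by
  have h1 : Differentiable ℝ (fderiv ℝ ξ) :=
    (hξ.smooth.fderiv_right (m := 1) (by norm_cast)).differentiable (by simp)
  have h2 : Differentiable ℝ (extDeriv ξ) :=
    (ContinuousAlternatingMap.alternatizeUncurryFinCLM ℝ (Cn (m + 1)) ℂ).differentiable.comp h1
  have h3 : dc ξ = fun z => ((2 * Real.pi)⁻¹ : ℝ) •
      ContinuousAlternatingMap.compContinuousLinearMapCLM
        ((-Complex.I) • ContinuousLinearMap.id ℝ (Cn (m + 1))) (extDeriv ξ z) :=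
    funext fun z => dc_eq hξ z
  rw [h3]
  have h4 := (ContinuousAlternatingMap.compContinuousLinearMapCLM (ι := Fin (2 * m + 1)) (F := ℂ)
    ((-Complex.I) • ContinuousLinearMap.id ℝ (Cn (m + 1)))).differentiable.comp h2
  exact h4.const_smul ((2 * Real.pi)⁻¹ : ℝ)

theorem ddc_apply (hξ : IsTestForm ξ) (z : Cn (m + 1)) (v : Fin (2 * m + 2) → Cn (m + 1)) :
    ddc ξ z v = ((2 * Real.pi)⁻¹ : ℝ) • ∑ j : Fin (2 * m + 2), ∑ i : Fin (2 * m + 1),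
      ((-1 : ℝ) ^ (j : ℕ) * (-1) ^ (i : ℕ)) •
      lineDeriv ℝ (fun z => lineDeriv ℝ (fun z' => ξ z' (i.removeNth (j.removeNth v))) z
        (-(Complex.I • j.removeNth v i))) z (v j) := by
  rw [ddc, extDeriv_apply_eq (differentiable_dc hξ), Finset.smul_sum]
  refine Finset.sum_congr rfl fun j _ => ?_
  simp only [dc_apply hξ]
  have h : ∀ i : Fin (2 * m + 1), HasLineDerivAt ℝ (fun z => (-1) ^ (i : ℕ) •
      lineDeriv ℝ (fun z' => ξ z' (i.removeNth (j.removeNth v))) z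
        (-(Complex.I • j.removeNth v i))) ((-1) ^ (i : ℕ) •
      lineDeriv ℝ (fun z => lineDeriv ℝ (fun z' => ξ z' (i.removeNth (j.removeNth v))) z
        (-(Complex.I • j.removeNth v i))) z (v j)) z (v j) := fun i =>
    HasDerivAt.const_smul _ (((hξ.isTest_apply _).lineDeriv _).hasLineDerivAt z (v j))
  have h2 : HasLineDerivAt ℝ (fun z => ((2 * Real.pi)⁻¹ : ℝ) • ∑ i : Fin (2 * m + 1),
      (-1) ^ (i : ℕ) • lineDeriv ℝ (fun z' => ξ z' (i.removeNth (j.removeNth v))) z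
        (-(Complex.I • j.removeNth v i))) (((2 * Real.pi)⁻¹ : ℝ) • ∑ i : Fin (2 * m + 1),
      (-1) ^ (i : ℕ) • lineDeriv ℝ (fun z => lineDeriv ℝ
        (fun z' => ξ z' (i.removeNth (j.removeNth v))) z
        (-(Complex.I • j.removeNth v i))) z (v j)) z (v j) :=
    HasDerivAt.const_smul ((2 * Real.pi)⁻¹ : ℝ)
      (HasDerivAt.fun_sum (u := Finset.univ) fun i _ => h i)
  rw [h2.lineDeriv, smul_comm, Finset.smul_sum]
  congr 1
  refine Finset.sum_congr rfl fun i _ => ?_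
  rw [mul_smul]
  simp [Complex.real_smul, zsmul_eq_mul]

end

end Coamoeba

namespace Coamoeba

noncomputable section

/-! ### Integration against functions of one complex coordinate -/

variable {m : ℕ} {ξ : Cn (m + 1) → AltForm (m + 1) (2 * m)}
  (e : OrthonormalBasis (Fin (m + 1)) ℂ (Cn (m + 1)))

theorem frame_zero : frame e 0 = e 0 := by
  simp only [frame]
  simp

theorem frame_succ_zero : frame e (Fin.succ 0) = Complex.I • e 0 := by
  simp only [frame]
  simp

theorem inner_frame_succ_succ (k : Fin (2 * m)) : inner ℂ (e 0) (frame e k.succ.succ) = 0 := by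
  simp only [frame, inner_smul_right]
  have : (0 : Fin (m + 1)) ≠ ⟨((k.succ.succ : Fin (2 * m + 2)) : ℕ) / 2, by omega⟩ := by
    rw [Ne, Fin.ext_iff]
    simp only [Fin.val_succ, Fin.val_zero]
    omega
  rw [e.orthonormal.2 this, mul_zero]

/-- The coefficient of a `2m`-form on the part of the frame of `e` which is transverse to `e₀`. -/
def transCoeff (ξ : Cn (m + 1) → AltForm (m + 1) (2 * m)) (z : Cn (m + 1)) : ℂ :=
  ξ z fun k => frame e (Fin.succ (Fin.succ k))

theorem IsTestForm.isTest_transCoeff (hξ : IsTestForm ξ) : IsTest (transCoeff e ξ) :=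
  hξ.isTest_apply _

theorem wedgeOne_apply {n k : ℕ} (η : AltForm n k) (θ : Cn n →L[ℝ] ℝ) (v : Fin (k + 1) → Cn n) :
    wedgeOne η θ v = (-1 : ℝ) ^ k • ∑ i : Fin (k + 1), (-1) ^ (i : ℕ) • θ (v i) •
      η (i.removeNth v) := by
  rw [wedgeOne, ContinuousAlternatingMap.smul_apply,
    ContinuousAlternatingMap.alternatizeUncurryFin_apply]
  rfl

theorem sum_fin_eq_one {k : ℕ} (f : Fin (k + 1) → ℂ) (h : ∀ j : Fin k, f j.succ = 0) :
    ∑ j, f j = f 0 := by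
  rw [Fin.sum_univ_succ, Finset.sum_congr rfl fun j _ => h j, Finset.sum_const_zero, add_zero]

theorem sum_fin_eq_two {k : ℕ} (f : Fin (k + 1 + 1) → ℂ) (h : ∀ j : Fin k, f j.succ.succ = 0) :
    ∑ j, f j = f 0 + f (Fin.succ 0) := by
  rw [Fin.sum_univ_succ, sum_fin_eq_one _ h]

theorem removeNth_one_zero :
    (Fin.succ 0 : Fin (2 * m + 1 + 1)).removeNth (frame e) 0 = frame e 0 := by
  simp [Fin.removeNth]

theorem removeNth_one_succ (i : Fin (2 * m)) :
    (Fin.succ 0 : Fin (2 * m + 1 + 1)).removeNth (frame e) i.succ = frame e i.succ.succ := by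
  rw [Fin.removeNth, Fin.succ_succAbove_succ, Fin.zero_succAbove]

theorem removeNth_zero_removeNth_zero :
    (0 : Fin (2 * m + 1)).removeNth ((0 : Fin (2 * m + 1 + 1)).removeNth (frame e)) =
      fun k => frame e (Fin.succ (Fin.succ k)) := rfl

theorem removeNth_zero_removeNth_one :
    (0 : Fin (2 * m + 1)).removeNth ((Fin.succ 0 : Fin (2 * m + 1 + 1)).removeNth (frame e)) =
      fun k => frame e (Fin.succ (Fin.succ k)) := by
  ext1 k
  exact removeNth_one_succ e k

/-- One term survives in each expansion: `θ'` is nonzero on the frame only at `i e₀`, and once that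
vector is removed `θ` is nonzero only at `e₀`. The signs `(-1)^(2m+1)` of the outer wedge and
`(-1)^1` of the slot of `i e₀` cancel. -/
theorem wedgeOne_frame_eq_transCoeff (η : AltForm (m + 1) (2 * m)) (θ θ' : Cn (m + 1) →L[ℝ] ℝ)
    (h : ∀ z, θ z = (inner ℂ (e 0) z).re) (h' : ∀ z, θ' z = (inner ℂ (e 0) z).im) :
    wedgeOne (wedgeOne η θ) θ' (frame e) = η fun k => frame e (Fin.succ (Fin.succ k)) := by
  have hone : inner ℂ (e 0) (e 0) = (1 : ℂ) := by
    rw [inner_self_eq_norm_sq_to_K, e.orthonormal.1]; simp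
  have t0 : θ (frame e 0) = 1 := by rw [h, frame_zero, hone]; simp
  have t2 : ∀ k : Fin (2 * m), θ (frame e k.succ.succ) = 0 := fun k => by
    rw [h, inner_frame_succ_succ]; simp
  have t0' : θ' (frame e 0) = 0 := by rw [h', frame_zero, hone]; simp
  have t1' : θ' (frame e (Fin.succ 0)) = 1 := by
    rw [h', frame_succ_zero, inner_smul_right, hone]; simp
  have t2' : ∀ k : Fin (2 * m), θ' (frame e k.succ.succ) = 0 := fun k => by
    rw [h', inner_frame_succ_succ]; simp
  have hin : wedgeOne η θ ((Fin.succ 0 : Fin (2 * m + 1 + 1)).removeNth (frame e)) =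
      η fun k => frame e (Fin.succ (Fin.succ k)) := by
    rw [wedgeOne_apply, sum_fin_eq_one _ fun j => by
      rw [removeNth_one_succ, t2, zero_smul, smul_zero], removeNth_one_zero, t0,
      removeNth_zero_removeNth_one]
    simp [pow_mul]
  rw [wedgeOne_apply, sum_fin_eq_two _ fun j => by rw [t2', zero_smul, smul_zero], t0', t1', hin]
  simp [pow_succ, pow_mul]

theorem topCoeff_ddc (hξ : IsTestForm ξ) (z : Cn (m + 1)) :
    topCoeff (ddc ξ z) = ((2 * Real.pi)⁻¹ : ℝ) • ∑ j : Fin (2 * m + 1 + 1), ∑ i : Fin (2 * m + 1),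
      ((-1 : ℝ) ^ (j : ℕ) * (-1) ^ (i : ℕ)) •
      lineDeriv ℝ (fun z => lineDeriv ℝ
        (fun z' => ξ z' (i.removeNth (j.removeNth (frame e)))) z
        (-(Complex.I • j.removeNth (frame e) i))) z (frame e j) := by
  rw [topCoeff_eq_apply_frame e]
  exact ddc_apply hξ z (frame e)

theorem IsTestForm.isTest_topCoeff_ddc (hξ : IsTestForm ξ) :
    IsTest fun z => topCoeff (ddc ξ z) := by
  simp only [topCoeff_ddc (EuclideanSpace.basisFun _ ℂ) hξ]
  have key : ∀ j : Fin (2 * m + 1 + 1), ∀ i : Fin (2 * m + 1), IsTest fun z =>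
      lineDeriv ℝ (fun z => lineDeriv ℝ
        (fun z' => ξ z' (i.removeNth (j.removeNth (frame (EuclideanSpace.basisFun _ ℂ))))) z
        (-(Complex.I • j.removeNth (frame (EuclideanSpace.basisFun _ ℂ)) i))) z
        (frame (EuclideanSpace.basisFun _ ℂ) j) := fun j i =>
    ((hξ.isTest_apply _).lineDeriv _).lineDeriv _
  have hs : ∀ {φ : Cn (m + 1) → ℂ} (r : ℝ), IsTest φ → IsTest fun z => r • φ z := fun r hφ =>
    ⟨hφ.smooth.const_smul r, hφ.compact.smul_left (f := fun _ => r)⟩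
  have hsum : ∀ {ι : Type} (s : Finset ι) (φ : ι → Cn (m + 1) → ℂ), (∀ i, IsTest (φ i)) →
      IsTest fun z => ∑ i ∈ s, φ i z := by
    intro ι s φ h
    classical
    induction s using Finset.induction_on with
    | empty => exact ⟨by simpa using contDiff_const, by simpa using! HasCompactSupport.zero⟩
    | insert i s hi ih => simpa [Finset.sum_insert hi] using (h i).add ih
  exact hs _ (hsum _ _ fun j => hsum _ _ fun i => hs _ (key j i))

theorem integral_smul_topCoeff_ddc (hξ : IsTestForm ξ) {u : Cn (m + 1) → ℝ}
    (hu : LocallyIntegrable u) :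
    ∫ z, u z • topCoeff (ddc ξ z) = ((2 * Real.pi)⁻¹ : ℝ) •
      ∑ j : Fin (2 * m + 1 + 1), ∑ i : Fin (2 * m + 1), ((-1 : ℝ) ^ (j : ℕ) * (-1) ^ (i : ℕ)) •
      ∫ z, u z • lineDeriv ℝ (fun z => lineDeriv ℝ
        (fun z' => ξ z' (i.removeNth (j.removeNth (frame e)))) z
        (-(Complex.I • j.removeNth (frame e) i))) z (frame e j) := by
  have key : ∀ j : Fin (2 * m + 1 + 1), ∀ i : Fin (2 * m + 1), IsTest fun z =>
      lineDeriv ℝ (fun z => lineDeriv ℝ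
        (fun z' => ξ z' (i.removeNth (j.removeNth (frame e)))) z
        (-(Complex.I • j.removeNth (frame e) i))) z (frame e j) := fun j i =>
    ((hξ.isTest_apply _).lineDeriv _).lineDeriv _
  have h1 : ∀ z, u z • topCoeff (ddc ξ z) = ((2 * Real.pi)⁻¹ : ℝ) •
      ∑ j : Fin (2 * m + 1 + 1), ∑ i : Fin (2 * m + 1), ((-1 : ℝ) ^ (j : ℕ) * (-1) ^ (i : ℕ)) •
      (u z • lineDeriv ℝ (fun z => lineDeriv ℝ
        (fun z' => ξ z' (i.removeNth (j.removeNth (frame e)))) z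
        (-(Complex.I • j.removeNth (frame e) i))) z (frame e j)) := by
    intro z
    rw [topCoeff_ddc e hξ, smul_comm, Finset.smul_sum]
    congr 1
    refine Finset.sum_congr rfl fun j _ => ?_
    rw [Finset.smul_sum]
    exact Finset.sum_congr rfl fun i _ => smul_comm _ _ _
  simp only [h1]
  rw [integral_smul, integral_finsetSum]
  · congr 1
    refine Finset.sum_congr rfl fun j _ => ?_
    rw [integral_finsetSum]
    · exact Finset.sum_congr rfl fun i _ => integral_smul _ _
    · intro i _
      exact ((key j i).integrable_smul hu).smul ((-1 : ℝ) ^ (j : ℕ) * (-1) ^ (i : ℕ))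
  · intro j _
    exact integrable_finsetSum _ fun i _ =>
      ((key j i).integrable_smul hu).smul ((-1 : ℝ) ^ (j : ℕ) * (-1) ^ (i : ℕ))

/-- Integration of `dd^c ξ` against a function of the coordinate along `e₀` only sees the Laplacian
in this coordinate. -/
theorem integral_smul_topCoeff_ddc_eq_lap (hξ : IsTestForm ξ) {u : Cn (m + 1) → ℝ}
    (hu : LocallyIntegrable u) (h : ∀ z v, inner ℂ (e 0) v = 0 → u (z + v) = u z) :
    ∫ z, u z • topCoeff (ddc ξ z) =
      ((2 * Real.pi)⁻¹ : ℝ) • ∫ z, u z • lap (e 0) (transCoeff e ξ) z := by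
  have hz : ∀ {φ : Cn (m + 1) → ℂ} {v : Cn (m + 1)}, IsTest φ → inner ℂ (e 0) v = 0 →
      ∫ z, u z • lineDeriv ℝ φ z v = 0 := fun {φ v} hφ hv =>
    hφ.integral_smul_lineDeriv_eq_zero hu fun z t => h z _ (by
      rw [← Complex.coe_smul, inner_smul_right, hv, mul_zero])
  -- Derivatives commute, so a transverse inner direction can be made the outer one.
  have hz' : ∀ {φ : Cn (m + 1) → ℂ} {v w : Cn (m + 1)}, IsTest φ → inner ℂ (e 0) v = 0 →
      ∫ z, u z • lineDeriv ℝ (fun z => lineDeriv ℝ φ z v) z w = 0 := fun {φ v w} hφ hv => by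
    simp only [hφ.lineDeriv_comm v w]
    exact hz (hφ.lineDeriv w) hv
  rw [integral_smul_topCoeff_ddc e hξ hu]
  congr 1
  -- Every term with a direction transverse to `e₀` integrates to zero. What remains is `j = 0, 1`
  -- with `i = 0`.
  rw [sum_fin_eq_two, sum_fin_eq_one, sum_fin_eq_one]
  rotate_left
  · intro i
    rw [hz' (hξ.isTest_apply _), smul_zero]
    rw [removeNth_one_succ, inner_neg_right, inner_smul_right, inner_frame_succ_succ, mul_zero,
      neg_zero]
  · intro i
    rw [hz' (hξ.isTest_apply _), smul_zero]
    have : (0 : Fin (2 * m + 1 + 1)).removeNth (frame e) i.succ = frame e i.succ.succ := rfl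
    rw [this, inner_neg_right, inner_smul_right, inner_frame_succ_succ, mul_zero, neg_zero]
  · intro j
    refine Finset.sum_eq_zero fun i _ => ?_
    rw [hz ((hξ.isTest_apply _).lineDeriv _) (inner_frame_succ_succ e j), smul_zero]
  rw [removeNth_zero_removeNth_zero, removeNth_zero_removeNth_one]
  -- For `j = 0` the inner direction is `-i(i e₀) = e₀`. For `j = 1` it is `-i e₀`, and this sign
  -- cancels against `(-1)^j`.
  have d0 : -(Complex.I • (0 : Fin (2 * m + 1 + 1)).removeNth (frame e) 0) = e 0 := by
    have : (0 : Fin (2 * m + 1 + 1)).removeNth (frame e) 0 = frame e (Fin.succ 0) := rfl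
    rw [this, frame_succ_zero, smul_smul, Complex.I_mul_I, neg_one_smul, neg_neg]
  have d1 : -(Complex.I • (Fin.succ 0 : Fin (2 * m + 1 + 1)).removeNth (frame e) 0) =
      -(Complex.I • e 0) := by
    rw [removeNth_one_zero, frame_zero]
  rw [d0, d1, frame_zero, frame_succ_zero]
  have hT := hξ.isTest_transCoeff e
  change (_ : ℝ) • (∫ z : Cn (m + 1), u z •
      lineDeriv ℝ (fun z => lineDeriv ℝ (transCoeff e ξ) z (e 0)) z (e 0)) +
    (_ : ℝ) • ∫ z : Cn (m + 1), u z • lineDeriv ℝ (fun z => lineDeriv ℝ (transCoeff e ξ) z (-(Complex.I • e 0))) z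
      (Complex.I • e 0) = _
  have d2 : ∀ z, lineDeriv ℝ (fun z => lineDeriv ℝ (transCoeff e ξ) z (-(Complex.I • e 0))) z
      (Complex.I • e 0) = -lineDeriv ℝ (fun z => lineDeriv ℝ (transCoeff e ξ) z (Complex.I • e 0)) z
      (Complex.I • e 0) := by
    intro z
    simp only [lineDeriv_neg]
    exact (((hT.lineDeriv _).hasLineDerivAt z (Complex.I • e 0)).neg).deriv
  simp only [d2, smul_neg, integral_neg, lap, smul_add]
  rw [integral_add (((hT.lineDeriv _).lineDeriv _).integrable_smul hu)
    (((hT.lineDeriv _).lineDeriv _).integrable_smul hu)]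
  simp

/-- Real affine functions are pluriharmonic. -/
theorem integral_affine_smul_topCoeff_ddc (hξ : IsTestForm ξ) (l : Cn (m + 1) →L[ℝ] ℝ) (r : ℝ) :
    ∫ z, (l z + r) • topCoeff (ddc ξ z) = 0 := by
  have hl : LocallyIntegrable (fun z => l z + r) (volume : Measure (Cn (m + 1))) :=
    (l.continuous.add_const r).locallyIntegrable
  rw [integral_smul_topCoeff_ddc (EuclideanSpace.basisFun _ ℂ) hξ hl]
  -- The first integration by parts leaves the constant `l w`, which the second one kills.
  have hz : ∀ {φ : Cn (m + 1) → ℂ} {v w : Cn (m + 1)}, IsTest φ →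
      ∫ z, (l z + r) • lineDeriv ℝ (fun z => lineDeriv ℝ φ z v) z w = 0 := fun {φ v w} hφ => by
    rw [(hφ.lineDeriv v).integral_smul_lineDeriv hl (locallyIntegrable_const (l w))
      (fun z => (l.hasFDerivAt.add_const r).hasLineDerivAt w),
      hφ.integral_smul_lineDeriv_eq_zero (locallyIntegrable_const (l w)) (fun _ _ => rfl), neg_zero]
  simp only [hz (hξ.isTest_apply _), smul_zero, Finset.sum_const_zero]

end

end Coamoeba

namespace Coamoeba

noncomputable section

/-! ### Coordinates adapted to the first vector of an orthonormal basis -/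

section Coordinates

variable {𝕜 : Type*} [RCLike 𝕜] {m : ℕ}
  (e : OrthonormalBasis (Fin (m + 1)) 𝕜 (EuclideanSpace 𝕜 (Fin (m + 1))))

/-- The point with coordinate `w` along `e₀` and coordinates `v` along the other vectors. -/
def adapt (w : 𝕜) (v : EuclideanSpace 𝕜 (Fin m)) : EuclideanSpace 𝕜 (Fin (m + 1)) :=
  w • e 0 + ∑ i : Fin m, v i • e i.succ

theorem adapt_eq (w : 𝕜) (v : EuclideanSpace 𝕜 (Fin m)) :
    adapt e w v = e.repr.symm (WithLp.toLp 2 (Fin.cons w v.ofLp)) := by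
  rw [← e.sum_repr_symm, Fin.sum_univ_succ]
  simp [adapt]

theorem norm_adapt_sq (w : 𝕜) (v : EuclideanSpace 𝕜 (Fin m)) :
    ‖adapt e w v‖ ^ 2 = ‖w‖ ^ 2 + ‖v‖ ^ 2 := by
  rw [adapt_eq, LinearIsometryEquiv.norm_map, EuclideanSpace.norm_sq_eq, Fin.sum_univ_succ,
    EuclideanSpace.norm_sq_eq]
  simp

theorem inner_adapt (w : 𝕜) (v : EuclideanSpace 𝕜 (Fin m)) : inner 𝕜 (e 0) (adapt e w v) = w := by
  rw [← e.repr_apply_apply, adapt_eq, LinearIsometryEquiv.apply_symm_apply]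
  simp

theorem adapt_add (w w' : 𝕜) (v v' : EuclideanSpace 𝕜 (Fin m)) :
    adapt e (w + w') (v + v') = adapt e w v + adapt e w' v' := by
  simp only [adapt, add_smul, PiLp.add_apply, Finset.sum_add_distrib]
  abel

theorem adapt_sub (w w' : 𝕜) (v v' : EuclideanSpace 𝕜 (Fin m)) :
    adapt e (w - w') (v - v') = adapt e w v - adapt e w' v' := by
  rw [eq_sub_iff_add_eq, ← adapt_add, sub_add_cancel, sub_add_cancel]

theorem adapt_smul (t w : 𝕜) (v : EuclideanSpace 𝕜 (Fin m)) :
    adapt e (t * w) (t • v) = t • adapt e w v := by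
  simp [adapt, mul_smul, smul_add, Finset.smul_sum]

/-- The coordinate along `e₀` as a homeomorphism with a product. -/
def adaptIsometry : WithLp 2 (𝕜 × EuclideanSpace 𝕜 (Fin m)) ≃ₗᵢ[𝕜] EuclideanSpace 𝕜 (Fin (m + 1)) :=
  LinearIsometry.toLinearIsometryEquiv
    { toFun := fun p => adapt e p.fst p.snd
      map_add' := fun p q => adapt_add e _ _ _ _
      map_smul' := fun t p => adapt_smul e t p.fst p.snd
      norm_map' := fun p => by
        rw [← sq_eq_sq₀ (norm_nonneg _) (norm_nonneg _)]
        change ‖adapt e p.fst p.snd‖ ^ 2 = _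
        rw [norm_adapt_sq, WithLp.prod_norm_sq_eq_of_L2] }
    (by
      rw [(WithLp.linearEquiv 2 𝕜 (𝕜 × EuclideanSpace 𝕜 (Fin m))).finrank_eq]
      simp [add_comm])

theorem adaptIsometry_apply (p : WithLp 2 (𝕜 × EuclideanSpace 𝕜 (Fin m))) :
    adaptIsometry e p = adapt e p.fst p.snd := rfl

theorem exists_eq_adapt (z : EuclideanSpace 𝕜 (Fin (m + 1))) :
    ∃ v, z = adapt e (inner 𝕜 (e 0) z) v := by
  obtain ⟨p, rfl⟩ := (adaptIsometry e).surjective z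
  exact ⟨p.snd, by rw [adaptIsometry_apply, inner_adapt]⟩

/-- The coordinates `(w, v) ↦ adapt e w v` as a homeomorphism. -/
def adaptHomeo : 𝕜 × EuclideanSpace 𝕜 (Fin m) ≃ₜ EuclideanSpace 𝕜 (Fin (m + 1)) :=
  (WithLp.prodContinuousLinearEquiv 2 𝕜 𝕜 (EuclideanSpace 𝕜 (Fin m))).symm.toHomeomorph.trans
    (adaptIsometry e).toHomeomorph

theorem adaptHomeo_apply (p : 𝕜 × EuclideanSpace 𝕜 (Fin m)) :
    adaptHomeo e p = adapt e p.1 p.2 := rfl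

theorem continuous_adapt : Continuous fun p : 𝕜 × EuclideanSpace 𝕜 (Fin m) => adapt e p.1 p.2 :=
  (adaptHomeo e).continuous

theorem adaptHomeo_symm_fst (z : EuclideanSpace 𝕜 (Fin (m + 1))) :
    ((adaptHomeo e).symm z).1 = inner 𝕜 (e 0) z := by
  conv_rhs => rw [← (adaptHomeo e).apply_symm_apply z, adaptHomeo_apply, inner_adapt]

end Coordinates

theorem measurePreserving_adaptHomeo_complex {m : ℕ}
    (e : OrthonormalBasis (Fin (m + 1)) ℂ (Cn (m + 1))) : MeasurePreserving (adaptHomeo e) := by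
  let f : WithLp 2 (ℂ × Cn m) ≃ₗᵢ[ℝ] Cn (m + 1) :=
    ⟨(adaptIsometry e).toLinearEquiv.restrictScalars ℝ, (adaptIsometry e).norm_map⟩
  exact f.measurePreserving.comp (WithLp.volume_preserving_toLp ℂ (Cn m))

theorem measurePreserving_adaptHomeo_real {m : ℕ}
    (e : OrthonormalBasis (Fin (m + 1)) ℝ (Rn (m + 1))) : MeasurePreserving (adaptHomeo e) :=
  (adaptIsometry e).measurePreserving.comp (WithLp.volume_preserving_toLp ℝ (Rn m))

variable {m : ℕ} (e : OrthonormalBasis (Fin (m + 1)) ℂ (Cn (m + 1)))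

theorem ae_inner {p : ℂ → Prop} (hp : ∀ᵐ w, p w) : ∀ᵐ z : Cn (m + 1), p (inner ℂ (e 0) z) := by
  have h1 : ∀ᵐ q : ℂ × Cn m, p q.1 := Measure.quasiMeasurePreserving_fst.ae hp
  have h2 := (measurePreserving_adaptHomeo_complex e).symm (adaptHomeo e).toMeasurableEquiv
  filter_upwards [h2.quasiMeasurePreserving.ae h1] with z hz
  rw [← adaptHomeo_symm_fst]
  exact hz

theorem locallyIntegrable_comp_inner {g : ℂ → ℝ} (hg : LocallyIntegrable g) :
    LocallyIntegrable fun z : Cn (m + 1) => g (inner ℂ (e 0) z) := by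
  rw [locallyIntegrable_iff]
  intro K hK
  let K' := (adaptHomeo e) ⁻¹' K
  have hK' : IsCompact K' := (adaptHomeo e).isCompact_preimage.2 hK
  have h1 : IntegrableOn (fun q : ℂ × Cn m => g q.1) ((Prod.fst '' K') ×ˢ (Prod.snd '' K')) := by
    have h2 : IntegrableOn g (Prod.fst '' K') :=
      hg.integrableOn_isCompact (hK'.image continuous_fst)
    have h3 : IsFiniteMeasure ((volume : Measure (Cn m)).restrict (Prod.snd '' K')) :=
      ⟨by simpa using (hK'.image continuous_snd).measure_lt_top⟩
    unfold IntegrableOn at h2 ⊢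
    rw [Measure.volume_eq_prod, ← Measure.prod_restrict]
    exact h2.comp_fst _
  have h4 : IntegrableOn (fun q : ℂ × Cn m => g q.1) K' :=
    h1.mono_set fun q hq => ⟨⟨q, hq, rfl⟩, ⟨q, hq, rfl⟩⟩
  refine ((measurePreserving_adaptHomeo_complex e).integrableOn_comp_preimage
    (adaptHomeo e).measurableEmbedding).1 ?_
  have h5 : (fun z => g (inner ℂ (e 0) z)) ∘ ⇑(adaptHomeo e) = fun q : ℂ × Cn m => g q.1 :=
    funext fun q => by rw [Function.comp_apply, adaptHomeo_apply, inner_adapt]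
  rw [h5]
  exact h4

/-- The integral of `h` over the complex hyperplane where the coordinate along `e₀` is `w`. -/
def fiberIntegral (h : Cn (m + 1) → ℂ) (w : ℂ) : ℂ := ∫ v : Cn m, h (adapt e w v)

theorem adapt_eq_add (w : ℂ) (v : Cn m) :
    adapt e w v = adapt e 0 v + ContinuousLinearMap.toSpanSingleton ℂ (e 0) w := by
  simp [adapt, add_comm]

theorem isClosedEmbedding_adapt_left (v : Cn m) :
    IsClosedEmbedding fun w : ℂ => adapt e 0 v + ContinuousLinearMap.toSpanSingleton ℂ (e 0) w := by
  simp only [← adapt_eq_add]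
  have h1 : Isometry fun w : ℂ => ((w, v) : ℂ × Cn m) :=
    Isometry.of_dist_eq fun x y => by simp [Prod.dist_eq]
  exact (adaptHomeo e).isClosedEmbedding.comp h1.isClosedEmbedding

theorem isClosedEmbedding_adapt_right (w : ℂ) : IsClosedEmbedding fun v : Cn m => adapt e w v := by
  have h1 : Isometry fun v : Cn m => ((w, v) : ℂ × Cn m) :=
    Isometry.of_dist_eq fun x y => by simp [Prod.dist_eq]
  exact (adaptHomeo e).isClosedEmbedding.comp h1.isClosedEmbedding

theorem integrable_comp_adapt {h : Cn (m + 1) → ℂ} (hc : Continuous h) (hs : HasCompactSupport h)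
    (w : ℂ) : Integrable fun v : Cn m => h (adapt e w v) :=
  (hc.comp (isClosedEmbedding_adapt_right e w).continuous).integrable_of_hasCompactSupport
    (hs.comp_isClosedEmbedding (isClosedEmbedding_adapt_right e w))

/-- Fubini along the complex lines parallel to `e₀`, with the planar identity on each line; one set
`K` serves all of them. -/
theorem integral_log_smul_lap {h : Cn (m + 1) → ℂ} (hh : IsTest h) {a : ℂ} (ha : a ≠ 0)
    {c : ℝ} (hc : 0 < c) (K : Finset ℤ)
    (hK : ∀ k ∉ K, ∀ v, h (adapt e (c⁻¹ • (Complex.log a + period k)) v) = 0)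
    (hu : LocallyIntegrable fun w : ℂ => Real.log ‖Complex.exp (c • w) - a‖) :
    ∫ z, Real.log ‖Complex.exp (c • inner ℂ (e 0) z) - a‖ • lap (e 0) h z =
      (2 * Real.pi) • ∑ k ∈ K, fiberIntegral e h (c⁻¹ • (Complex.log a + period k)) := by
  have hmp := measurePreserving_adaptHomeo_complex e
  have hint := (hh.lap (e 0)).integrable_smul (locallyIntegrable_comp_inner e hu)
  rw [← hmp.integral_comp (adaptHomeo e).measurableEmbedding, Measure.volume_eq_prod,
    integral_prod_symm]
  · have h1 : ∀ v : Cn m, ∫ w : ℂ, Real.log ‖Complex.exp (c • inner ℂ (e 0) (adaptHomeo e (w, v)))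
        - a‖ • lap (e 0) h (adaptHomeo e (w, v)) =
        (2 * Real.pi) • ∑ k ∈ K, h (adapt e (c⁻¹ • (Complex.log a + period k)) v) := by
      intro v
      have ht : IsTest fun w : ℂ =>
          h (adapt e 0 v + ContinuousLinearMap.toSpanSingleton ℂ (e 0) w) :=
        ⟨hh.smooth.comp (contDiff_const.add
          ((ContinuousLinearMap.toSpanSingleton ℂ (e 0)).restrictScalars ℝ).contDiff),
          hh.compact.comp_isClosedEmbedding (isClosedEmbedding_adapt_left e v)⟩
      have := integral_log_norm_exp_sub_smul_lap ht ha hc K (fun k hk => by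
        rw [← adapt_eq_add]; exact hK k hk v)
      have h2 : ∀ w : ℂ, lap 1 (fun w : ℂ =>
          h (adapt e 0 v + ContinuousLinearMap.toSpanSingleton ℂ (e 0) w)) w =
          lap (e 0) h (adapt e w v) := fun w => by
        rw [lap_comp_affine, ← adapt_eq_add, ContinuousLinearMap.toSpanSingleton_apply, one_smul]
      simp only [h2] at this
      simp only [← adapt_eq_add] at this
      simpa [adaptHomeo_apply, inner_adapt] using this
    simp only [h1]
    rw [integral_smul, integral_finsetSum]
    · rfl
    · intro k _
      exact integrable_comp_adapt e hh.continuous hh.compact _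
  · rw [← Measure.volume_eq_prod]
    exact (hmp.integrable_comp_emb (adaptHomeo e).measurableEmbedding).2 hint

theorem locallyIntegrable_log_norm_exp_smul_sub (a : ℂ) {c : ℝ} (hc : 0 < c) :
    LocallyIntegrable fun w : ℂ => Real.log ‖Complex.exp (c • w) - a‖ := by
  rw [locallyIntegrable_iff]
  intro K hK
  let s : ℂ ≃ₜ ℂ := Homeomorph.smulOfNeZero c hc.ne'
  have h1 : IntegrableOn (fun w : ℂ => Real.log ‖Complex.exp w - a‖) (s '' K) :=
    (locallyIntegrable_log_norm_exp_sub a).integrableOn_isCompact (hK.image s.continuous)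
  have h2 := (integrableOn_image_iff_integrableOn_abs_det_fderiv_smul volume hK.measurableSet
    (f := s) (f' := fun _ => c • ContinuousLinearMap.id ℝ ℂ) (fun x _ =>
      ((c • ContinuousLinearMap.id ℝ ℂ).hasFDerivAt).hasFDerivWithinAt) s.injective.injOn
      (fun w : ℂ => Real.log ‖Complex.exp w - a‖)).1 h1
  have h3 : |(c • ContinuousLinearMap.id ℝ ℂ).det| ≠ 0 := by
    simp [ContinuousLinearMap.det, hc.ne']
  have h4 := h2.smul (|(c • ContinuousLinearMap.id ℝ ℂ).det|)⁻¹
  refine h4.congr (Eventually.of_forall fun w => ?_)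
  simp only [Pi.smul_apply, smul_smul, inv_mul_cancel₀ h3, one_smul]
  rfl

end

end Coamoeba

namespace Coamoeba

noncomputable section

/-! ### The Lelong current of an exponential polynomial in one variable -/

/-- The zeros `(log a + 2πik) / c` of `exp (c w) - a`. -/
def zeroPt (c : ℝ) (a : ℂ) (k : ℤ) : ℂ := c⁻¹ • (Complex.log a + period k)

theorem log_norm_eval_eq {P : ℂ[X]} (hP : P ≠ 0) {x : ℂ} (hx : ∀ a ∈ P.roots, x ≠ a) :
    Real.log ‖P.eval x‖ = Real.log ‖P.leadingCoeff‖ +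
      ∑ a ∈ P.roots.toFinset, (P.rootMultiplicity a : ℝ) * Real.log ‖x - a‖ := by
  have h1 := Polynomial.C_leadingCoeff_mul_prod_multiset_X_sub_C
    (IsAlgClosed.card_roots_eq_natDegree (p := P))
  rw [Polynomial.prod_multiset_root_eq_finset_root] at h1
  have h2 : ∀ a ∈ P.roots.toFinset, ‖(x - a) ^ P.rootMultiplicity a‖ ≠ 0 := by
    intro a ha
    rw [norm_ne_zero_iff]
    exact pow_ne_zero _ (sub_ne_zero.2 (hx a (Multiset.mem_toFinset.1 ha)))
  conv_lhs => rw [← h1]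
  rw [Polynomial.eval_mul, Polynomial.eval_C, Polynomial.eval_prod, norm_mul, norm_prod]
  simp only [Polynomial.eval_pow, Polynomial.eval_sub, Polynomial.eval_X, Polynomial.eval_C]
  rw [Real.log_mul (norm_ne_zero_iff.2 (Polynomial.leadingCoeff_ne_zero.2 hP))
    (Finset.prod_ne_zero_iff.2 h2), Real.log_prod h2]
  congr 1
  refine Finset.sum_congr rfl fun a _ => ?_
  rw [norm_pow, Real.log_pow]

variable {m : ℕ} {ξ : Cn (m + 1) → AltForm (m + 1) (2 * m)}
  (e : OrthonormalBasis (Fin (m + 1)) ℂ (Cn (m + 1)))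

/-- `f` has the form `exp (l z) * P (exp (c * w))` up to a factor of modulus one, where `w` is the
coordinate along `e₀`. -/
structure IsOneVariable (f : Cn (m + 1) → ℂ) (P : ℂ[X]) (c : ℝ) (l : Cn (m + 1) →L[ℝ] ℝ) :
    Prop where
  pos : 0 < c
  coeff_zero_ne_zero : P.coeff 0 ≠ 0
  norm_eq : ∀ z, ‖f z‖ = Real.exp (l z) * ‖P.eval (Complex.exp (c • inner ℂ (e 0) z))‖

variable {e} {f : Cn (m + 1) → ℂ} {P : ℂ[X]} {c : ℝ} {l : Cn (m + 1) →L[ℝ] ℝ}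

theorem IsOneVariable.ne_zero (hf : IsOneVariable e f P c l) : P ≠ 0 := by
  rintro rfl
  exact hf.coeff_zero_ne_zero (by simp)

theorem ne_zero_of_mem_roots (hP : P.coeff 0 ≠ 0) {a : ℂ} (ha : a ∈ P.roots) : a ≠ 0 := by
  rintro rfl
  have := Polynomial.isRoot_of_mem_roots ha
  rw [Polynomial.IsRoot.def, ← Polynomial.coeff_zero_eq_eval_zero] at this
  exact hP this

/-- The factorization of `P` can be put under the logarithm unless `e^{cw} = a` for a root `a`,
which forces `Re w = c⁻¹ log|a|`, a null condition. -/
theorem IsOneVariable.lelongDensity_ae_eq (hf : IsOneVariable e f P c l) :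
    lelongDensity f ξ =ᵐ[volume] fun z =>
      (l z + Real.log ‖P.leadingCoeff‖) • topCoeff (ddc ξ z) +
      ∑ a ∈ P.roots.toFinset, (P.rootMultiplicity a : ℝ) •
        (Real.log ‖Complex.exp (c • inner ℂ (e 0) z) - a‖ • topCoeff (ddc ξ z)) := by
  have h1 : ∀ᵐ w : ℂ, ∀ a ∈ P.roots.toFinset, w.re ≠ c⁻¹ * Real.log ‖a‖ := by
    exact (ae_ball_iff P.roots.toFinset.countable_toSet).2 fun a _ => ae_re_ne _
  filter_upwards [ae_inner e h1] with z hz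
  have h2 : ∀ a ∈ P.roots, Complex.exp (c • inner ℂ (e 0) z) ≠ a := by
    intro a ha h
    apply hz a (Multiset.mem_toFinset.2 ha)
    have := congrArg (fun x => Real.log ‖x‖) h
    simp only [Complex.norm_exp, Real.log_exp, Complex.smul_re, smul_eq_mul] at this
    rw [← this, inv_mul_cancel_left₀ hf.pos.ne']
  have h3 : ‖P.eval (Complex.exp (c • inner ℂ (e 0) z))‖ ≠ 0 := by
    rw [norm_ne_zero_iff]
    intro h
    exact h2 _ ((Polynomial.mem_roots hf.ne_zero).2 h) rfl
  rw [lelongDensity, hf.norm_eq, Real.log_mul (Real.exp_pos _).ne' h3, Real.log_exp,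
    log_norm_eval_eq hf.ne_zero h2, ← Complex.real_smul, ← add_assoc, add_smul, Finset.sum_smul]
  simp only [mul_smul]

theorem IsOneVariable.integrable_summand (hf : IsOneVariable e f P c l) (hξ : IsTestForm ξ)
    (a : ℂ) : Integrable fun z =>
      Real.log ‖Complex.exp (c • inner ℂ (e 0) z) - a‖ • topCoeff (ddc ξ z) :=
  hξ.isTest_topCoeff_ddc.integrable_smul
    (locallyIntegrable_comp_inner e (locallyIntegrable_log_norm_exp_smul_sub a hf.pos))

theorem integrable_affine (hξ : IsTestForm ξ) (r : ℝ) :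
    Integrable fun z => (l z + r) • topCoeff (ddc ξ z) :=
  hξ.isTest_topCoeff_ddc.integrable_smul (l.continuous.add_const r).locallyIntegrable

theorem IsOneVariable.integrable_lelongDensity (hf : IsOneVariable e f P c l)
    (hξ : IsTestForm ξ) : Integrable (lelongDensity f ξ) := by
  refine Integrable.congr ?_ hf.lelongDensity_ae_eq.symm
  exact (integrable_affine hξ _).add (integrable_finsetSum _ fun a _ =>
    (hf.integrable_summand hξ a).smul (P.rootMultiplicity a : ℝ))

/-- The Lelong current is the sum of the integration currents over the complex hyperplanes where
`f` vanishes. -/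
theorem IsOneVariable.lelong_eq (hf : IsOneVariable e f P c l) (hξ : IsTestForm ξ) (K : Finset ℤ)
    (hK : ∀ a ∈ P.roots, ∀ k ∉ K, ∀ v, transCoeff e ξ (adapt e (zeroPt c a k) v) = 0) :
    lelong f ξ = ∑ a ∈ P.roots.toFinset, (P.rootMultiplicity a : ℂ) *
      ∑ k ∈ K, fiberIntegral e (transCoeff e ξ) (zeroPt c a k) := by
  have hi : ∀ a : ℂ, Integrable fun z => (P.rootMultiplicity a : ℝ) •
      (Real.log ‖Complex.exp (c • inner ℂ (e 0) z) - a‖ • topCoeff (ddc ξ z)) := fun a =>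
    (hf.integrable_summand hξ a).smul (P.rootMultiplicity a : ℝ)
  rw [lelong, integral_congr_ae hf.lelongDensity_ae_eq, integral_add (integrable_affine hξ _)
    (integrable_finsetSum _ fun a _ => hi a),
    integral_affine_smul_topCoeff_ddc hξ, zero_add, integral_finsetSum _ fun a _ => hi a]
  refine Finset.sum_congr rfl fun a ha => ?_
  have ha' := Multiset.mem_toFinset.1 ha
  have hu := locallyIntegrable_log_norm_exp_smul_sub a hf.pos
  rw [integral_smul, integral_smul_topCoeff_ddc_eq_lap e hξ (locallyIntegrable_comp_inner e hu)
      (fun z v hv => by rw [inner_add_right, hv, add_zero]),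
    integral_log_smul_lap e (hξ.isTest_transCoeff e)
      (ne_zero_of_mem_roots hf.coeff_zero_ne_zero ha') hf.pos K (hK a ha') hu, inv_smul_smul₀ Real.two_pi_pos.ne']
  simp [zeroPt]

/-! ### Translations -/

theorem IsTestForm.translate (hξ : IsTestForm ξ) (r : Rn (m + 1)) :
    IsTestForm (translate ξ r) where
  smooth := hξ.smooth.comp (contDiff_id.sub contDiff_const)
  compact := hξ.compact.comp_homeomorph (Homeomorph.subRight (realPt r))
  bidegree _ := hξ.bidegree _

theorem transCoeff_translate (r : Rn (m + 1)) (z : Cn (m + 1)) :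
    transCoeff e (translate ξ r) z = transCoeff e ξ (z - realPt r) := rfl

/-- The component of `r` transverse to `e₀` only shifts the integration variable in the fiber. -/
theorem fiberIntegral_translate (r : Rn (m + 1)) (w : ℂ) :
    fiberIntegral e (transCoeff e (translate ξ r)) w =
      fiberIntegral e (transCoeff e ξ) (w - inner ℂ (e 0) (realPt r)) := by
  obtain ⟨v₀, hv₀⟩ := exists_eq_adapt e (realPt r)
  simp only [fiberIntegral, transCoeff_translate]
  rw [hv₀]
  simp only [← adapt_sub, inner_adapt]
  exact integral_sub_right_eq_self (fun v => transCoeff e ξ (adapt e (w - _) v)) v₀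

theorem norm_fst_le_norm_adapt (w : ℂ) (v : Cn m) : ‖w‖ ≤ ‖adapt e w v‖ := by
  rw [← sq_le_sq₀ (norm_nonneg _) (norm_nonneg _), norm_adapt_sq]
  nlinarith [norm_nonneg v]

theorem norm_snd_le_norm_adapt (w : ℂ) (v : Cn m) : ‖v‖ ≤ ‖adapt e w v‖ := by
  rw [← sq_le_sq₀ (norm_nonneg _) (norm_nonneg _), norm_adapt_sq]
  nlinarith [norm_nonneg w]

theorem zeroPt_re (c : ℝ) (a : ℂ) (k : ℤ) : (zeroPt c a k).re = Real.log ‖a‖ / c := by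
  rw [zeroPt, Complex.smul_re, Complex.add_re, period_re, add_zero, Complex.log_re, smul_eq_mul,
    inv_mul_eq_div]

theorem zeroPt_im (c : ℝ) (a : ℂ) (k : ℤ) :
    (zeroPt c a k).im = (a.arg + 2 * Real.pi * k) / c := by
  rw [zeroPt, Complex.smul_im, Complex.add_im, period_im, Complex.log_im, smul_eq_mul,
    inv_mul_eq_div]

/-! ### Fiber integrals of compactly supported functions -/

section Fiber

variable {h : Cn (m + 1) → ℂ}

/-- Since `arg a ∈ (-π, π]`, a bound on `Im w` bounds `k` uniformly in `a`. The condition involves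
imaginary parts only, so the same `K` serves all real translates. -/
theorem exists_finset_zeroPt (hs : HasCompactSupport h) (hc : 0 < c) :
    ∃ K : Finset ℤ, ∀ a : ℂ, ∀ k ∉ K, ∀ w v, w.im = (zeroPt c a k).im → h (adapt e w v) = 0 := by
  obtain ⟨B, hB⟩ := hs.isBounded.exists_norm_le
  obtain ⟨N, hN⟩ := exists_nat_gt (B * c)
  refine ⟨Finset.Icc (-(N : ℤ)) N, fun a k hk w v hw => ?_⟩
  by_contra hne
  apply hk
  have h1 : |w.im| ≤ B := (Complex.abs_im_le_norm w).trans
    ((norm_fst_le_norm_adapt w v).trans (hB _ (subset_tsupport _ hne)))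
  rw [hw, zeroPt_im, abs_div, abs_of_pos hc, div_le_iff₀ hc] at h1
  have h2 := h1.trans_lt hN
  rw [abs_lt] at h2
  have h3 := Complex.arg_le_pi a
  have h4 := Complex.neg_pi_lt_arg a
  have hpi := Real.pi_gt_three
  rw [Finset.mem_Icc, ← abs_le]
  by_contra hcon
  have hcon' : (N : ℝ) + 1 ≤ |(k : ℝ)| := by
    have : (N : ℤ) + 1 ≤ |k| := by omega
    exact_mod_cast this
  rcases le_abs.1 hcon' with h | h
  · nlinarith
  · nlinarith

theorem continuous_fiberIntegral (hc : Continuous h) (hs : HasCompactSupport h) :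
    Continuous (fiberIntegral e h) := by
  obtain ⟨B, hB⟩ := hs.isBounded.exists_norm_le
  have h1 : fiberIntegral e h = fun w => ∫ v in Metric.closedBall (0 : Cn m) B, h (adapt e w v) := by
    ext w
    rw [fiberIntegral, setIntegral_eq_integral_of_forall_compl_eq_zero]
    intro v hv
    by_contra hne
    exact hv (mem_closedBall_zero_iff.2
      ((norm_snd_le_norm_adapt w v).trans (hB _ (subset_tsupport _ hne))))
  rw [h1]
  exact continuous_parametric_integral_of_continuous (f := fun w v => h (adapt e w v))
    (hc.comp (continuous_adapt e)) (isCompact_closedBall _ _)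

theorem hasCompactSupport_fiberIntegral (hs : HasCompactSupport h) :
    HasCompactSupport (fiberIntegral e h) := by
  obtain ⟨B, hB⟩ := hs.isBounded.exists_norm_le
  refine HasCompactSupport.intro (isCompact_closedBall (0 : ℂ) B) fun w hw => ?_
  rw [fiberIntegral]
  refine integral_eq_zero_of_ae (Eventually.of_forall fun v => ?_)
  by_contra hne
  exact hw (mem_closedBall_zero_iff.2
    ((norm_fst_le_norm_adapt w v).trans (hB _ (subset_tsupport _ hne))))

theorem exists_ne_zero_of_fiberIntegral_ne_zero {w : ℂ} (hw : fiberIntegral e h w ≠ 0) :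
    ∃ v, h (adapt e w v) ≠ 0 := by
  by_contra hcon
  push Not at hcon
  exact hw (by simp [fiberIntegral, hcon])

end Fiber

/-! ### Integration over the real hyperplanes -/

theorem finrank_hyperplane (m : ℕ) : Module.finrank ℝ (WithLp 2 (ℝ × Cn m)) = 2 * m + 1 := by
  rw [(WithLp.linearEquiv 2 ℝ (ℝ × Cn m)).finrank_eq]
  simp [finrank_real_of_complex (Cn m), add_comm]

theorem isometry_adapt (τ : ℝ) : Isometry fun p : WithLp 2 (ℝ × Cn m) =>
    adapt e ((p.fst : ℂ) + τ * Complex.I) p.snd := by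
  refine Isometry.of_dist_eq fun p q => ?_
  rw [dist_eq_norm, ← adapt_sub, ← sq_eq_sq₀ (norm_nonneg _) dist_nonneg, norm_adapt_sq,
    dist_eq_norm, WithLp.prod_norm_sq_eq_of_L2]
  have : (p.fst : ℂ) + τ * Complex.I - (q.fst + τ * Complex.I) = ((p - q).fst : ℝ) := by
    simp
  rw [this, Complex.norm_real]
  rfl

/-- The real hyperplane on which the coordinate along `e₀` has imaginary part `τ`. -/
def imHyperplane (e : OrthonormalBasis (Fin (m + 1)) ℂ (Cn (m + 1))) (τ : ℝ) : Set (Cn (m + 1)) :=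
  {z | (inner ℂ (e 0) z).im = τ}

theorem range_adapt (τ : ℝ) : (Set.range fun p : WithLp 2 (ℝ × Cn m) =>
    adapt e ((p.fst : ℂ) + τ * Complex.I) p.snd) = imHyperplane e τ := by
  ext z
  constructor
  · rintro ⟨p, rfl⟩
    simp [imHyperplane, inner_adapt]
  · intro hz
    obtain ⟨v, hv⟩ := exists_eq_adapt e z
    refine ⟨WithLp.toLp 2 ((inner ℂ (e 0) z).re, v), ?_⟩
    have hz' : (inner ℂ (e 0) z).im = τ := hz
    conv_rhs => rw [hv, ← Complex.re_add_im (inner ℂ (e 0) z), hz']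
    rfl

theorem measurableSet_imHyperplane (τ : ℝ) : MeasurableSet (imHyperplane e τ) := by
  have : Continuous fun z => (inner ℂ (e 0) z).im := by fun_prop
  exact this.measurable (measurableSet_singleton τ)

/-- The hyperplane is an isometric image of `ℝ × ℂᵐ`, of real dimension `2m + 1`, on which the
normalized Hausdorff measure is Lebesgue measure. -/
theorem restrict_imHyperplane (τ : ℝ) :
    (Measure.euclideanHausdorffMeasure (2 * m + 1)).restrict (imHyperplane e τ) =
      Measure.map (fun p : WithLp 2 (ℝ × Cn m) => adapt e ((p.fst : ℂ) + τ * Complex.I) p.snd)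
        volume := by
  rw [← range_adapt, ← (isometry_adapt τ).map_euclideanHausdorffMeasure,
    ← InnerProductSpace.euclideanHausdorffMeasure_eq_volume, finrank_hyperplane]

theorem integrableOn_imHyperplane {h : Cn (m + 1) → ℂ} (hc : Continuous h)
    (hs : HasCompactSupport h) (τ : ℝ) :
    IntegrableOn h (imHyperplane e τ) (Measure.euclideanHausdorffMeasure (2 * m + 1)) := by
  have hF := (isometry_adapt (e := e) τ).isClosedEmbedding
  rw [IntegrableOn, restrict_imHyperplane, hF.measurableEmbedding.integrable_map_iff]
  exact (hc.comp hF.continuous).integrable_of_hasCompactSupport (hs.comp_isClosedEmbedding hF)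

theorem setIntegral_imHyperplane {h : Cn (m + 1) → ℂ} (hc : Continuous h)
    (hs : HasCompactSupport h) (τ : ℝ) :
    ∫ z in imHyperplane e τ, h z ∂(Measure.euclideanHausdorffMeasure (2 * m + 1)) =
      ∫ x : ℝ, fiberIntegral e h (x + τ * Complex.I) := by
  have hF := (isometry_adapt (e := e) τ).isClosedEmbedding
  have h1 : Integrable (fun p : WithLp 2 (ℝ × Cn m) =>
      h (adapt e ((p.fst : ℂ) + τ * Complex.I) p.snd)) :=
    (hc.comp hF.continuous).integrable_of_hasCompactSupport (hs.comp_isClosedEmbedding hF)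
  have hmp := WithLp.volume_preserving_toLp ℝ (Cn m)
  have hemb : MeasurableEmbedding (WithLp.toLp 2 : ℝ × Cn m → WithLp 2 (ℝ × Cn m)) :=
    (WithLp.prodContinuousLinearEquiv 2 ℝ ℝ (Cn m)).symm.toHomeomorph.measurableEmbedding
  rw [restrict_imHyperplane, hF.measurableEmbedding.integral_map, ← hmp.integral_comp hemb,
    Measure.volume_eq_prod, integral_prod]
  · rfl
  · rw [← Measure.volume_eq_prod]
    exact (hmp.integrable_comp_emb hemb).2 h1

end

end Coamoeba

namespace Coamoeba

noncomputable section

/-! ### Averages over large balls -/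

section Average

variable {m : ℕ}

/-- The volume of the part of `C` in the ball of radius `ρ`. -/
def coneVol (C : Set (Rn m)) (ρ : ℝ) : ℝ := volume.real (C ∩ Metric.ball 0 ρ)

theorem coneVol_univ (ρ : ℝ) : coneVol (Set.univ : Set (Rn m)) ρ = kappa m ρ := by
  rw [coneVol, Set.univ_inter, kappa]

theorem coneVol_nonneg (C : Set (Rn m)) (ρ : ℝ) : 0 ≤ coneVol C ρ := measureReal_nonneg

theorem coneVol_mono {C C' : Set (Rn m)} (hC : C ⊆ C') {ρ ρ' : ℝ} (h : ρ ≤ ρ') :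
    coneVol C ρ ≤ coneVol C' ρ' :=
  measureReal_mono (Set.inter_subset_inter hC (Metric.ball_subset_ball h))
    (measure_ne_top_of_subset Set.inter_subset_right measure_ball_lt_top.ne)

theorem coneVol_eq {C : Set (Rn m)} (hC : ∀ t : ℝ, 0 < t → ∀ x ∈ C, t • x ∈ C) {ρ : ℝ}
    (hρ : 0 < ρ) : coneVol C ρ = ρ ^ m * coneVol C 1 := by
  have h1 : C ∩ Metric.ball 0 ρ = ρ • (C ∩ Metric.ball 0 1) := by
    ext x
    rw [Set.mem_smul_set_iff_inv_smul_mem₀ hρ.ne']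
    simp only [Set.mem_inter_iff, mem_ball_zero_iff, norm_smul, norm_inv, Real.norm_of_nonneg hρ.le]
    refine and_congr ⟨hC _ (inv_pos.2 hρ) x, fun h => ?_⟩ ?_
    · have := hC ρ hρ _ h
      rwa [smul_inv_smul₀ hρ.ne'] at this
    · rw [inv_mul_lt_iff₀ hρ, mul_one]
  rw [coneVol, h1, measureReal_def, Measure.addHaar_smul, ENNReal.toReal_mul, finrank_euclideanSpace,
    Fintype.card_fin, abs_of_pos (by positivity), ENNReal.toReal_ofReal (by positivity)]
  rfl

theorem kappa_pos {R : ℝ} (hR : 0 < R) : 0 < kappa m R :=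
  ENNReal.toReal_pos (Metric.measure_ball_pos _ _ hR).ne' measure_ball_lt_top.ne

variable (e : OrthonormalBasis (Fin (m + 1)) ℝ (Rn (m + 1)))

/-- Fubini along `e₀`: the slice of the ball at height `s` is a ball of radius `√(R² - s²)`. For
`|s| ≥ R` the root is 0 and the slice is empty. The shape of `D` matters only at heights where `Λ`
does not vanish, which is what lets a slab behave like a full cylinder. -/
theorem setIntegral_ball_inter_eq {Λ : ℝ → ℂ} (hΛ : Continuous Λ) {C : Set (Rn m)}
    (hC : MeasurableSet C) {D : Set (Rn (m + 1))} (hD : MeasurableSet D)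
    (h : ∀ s t, Λ s ≠ 0 → (adapt e s t ∈ D ↔ t ∈ C)) {R : ℝ} (hR : 0 < R) :
    ∫ r in Metric.ball 0 R ∩ D, Λ (inner ℝ (e 0) r) =
      ∫ s, coneVol C (√(R ^ 2 - s ^ 2)) • Λ s := by
  have hcont : Continuous fun r => Λ (inner ℝ (e 0) r) := hΛ.comp (by fun_prop)
  have hms : MeasurableSet (Metric.ball 0 R ∩ D) := measurableSet_ball.inter hD
  have hint : IntegrableOn (fun r => Λ (inner ℝ (e 0) r)) (Metric.ball 0 R ∩ D) :=
    (hcont.continuousOn.integrableOn_compact (isCompact_closedBall (0 : Rn (m + 1)) R)).mono_set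
      (Set.inter_subset_left.trans Metric.ball_subset_closedBall)
  have hmp := measurePreserving_adaptHomeo_real e
  have hemb := (adaptHomeo e).measurableEmbedding
  rw [← integral_indicator hms, ← hmp.integral_comp hemb, Measure.volume_eq_prod, integral_prod]
  · refine integral_congr_ae (Eventually.of_forall fun s => ?_)
    classical
    have h1 : ∀ t, (Metric.ball 0 R ∩ D).indicator (fun r => Λ (inner ℝ (e 0) r))
        (adaptHomeo e (s, t)) =
        (C ∩ Metric.ball 0 (√(R ^ 2 - s ^ 2))).indicator (fun _ => Λ s) t := by
      intro t
      rw [adaptHomeo_apply]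
      by_cases hs : Λ s = 0
      · rw [hs, Set.indicator_zero, Set.indicator_apply, inner_adapt, hs, ite_self]
      · rw [Set.indicator_apply, Set.indicator_apply, inner_adapt]
        congr 1
        rw [eq_iff_iff, Set.mem_inter_iff, Set.mem_inter_iff, h s t hs, and_comm]
        refine and_congr_right fun _ => ?_
        rw [mem_ball_zero_iff, mem_ball_zero_iff, Real.lt_sqrt (norm_nonneg _),
          ← sq_lt_sq₀ (norm_nonneg _) hR.le, norm_adapt_sq, Real.norm_eq_abs, sq_abs,
          lt_sub_iff_add_lt']
    simp only [h1]
    rw [integral_indicator_const _ (hC.inter measurableSet_ball)]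
    rfl
  · rw [← Measure.volume_eq_prod]
    exact (hmp.integrable_comp_emb hemb).2 ((integrable_indicator_iff hms).2 hint)

theorem tendsto_sqrt_sub_div (s : ℝ) : Tendsto (fun R : ℝ => √(R ^ 2 - s ^ 2) / R) atTop (𝓝 1) := by
  have h1 : Tendsto (fun R : ℝ => √(1 - (s / R) ^ 2)) atTop (𝓝 1) := by
    have h2 : Tendsto (fun R : ℝ => s / R) atTop (𝓝 0) := tendsto_const_nhds.div_atTop tendsto_id
    have h3 := ((h2.pow 2).const_sub 1).sqrt
    simpa using h3
  refine h1.congr' ?_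
  filter_upwards [eventually_gt_atTop 0] with R hR
  have : R ^ 2 - s ^ 2 = (1 - (s / R) ^ 2) * R ^ 2 := by field_simp
  rw [this, Real.sqrt_mul' _ (by positivity), Real.sqrt_sq hR.le, mul_div_cancel_right₀ _ hR.ne']

/-- The slice volumes are at most `κ(R)`, so `‖Λ‖` dominates; pointwise, homogeneity reduces the
ratio to `(√(R² - s²)/R)^m` times the constant. -/
theorem tendsto_setAverage {Λ : ℝ → ℂ} (hΛ : Continuous Λ) (hs : HasCompactSupport Λ)
    {C : Set (Rn m)} (hC : MeasurableSet C) (hcone : ∀ t : ℝ, 0 < t → ∀ x ∈ C, t • x ∈ C)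
    {D : Set (Rn (m + 1))} (hD : MeasurableSet D)
    (h : ∀ s t, Λ s ≠ 0 → (adapt e s t ∈ D ↔ t ∈ C)) :
    Tendsto (fun R => ((kappa m R)⁻¹ : ℝ) •
      ∫ r in Metric.ball 0 R ∩ D, Λ (inner ℝ (e 0) r)) atTop
      (𝓝 (((coneVol C 1 / kappa m 1 : ℝ) : ℂ) * ∫ s, Λ s)) := by
  have hlim : ((coneVol C 1 / kappa m 1 : ℝ) : ℂ) * ∫ s, Λ s =
      ∫ s, (coneVol C 1 / kappa m 1) • Λ s := by
    rw [integral_smul, Complex.real_smul]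
  rw [hlim]
  refine Tendsto.congr' (f₁ := fun R => ∫ s, ((kappa m R)⁻¹ * coneVol C (√(R ^ 2 - s ^ 2))) • Λ s)
    ?_ ?_
  · filter_upwards [eventually_gt_atTop 0] with R hR
    rw [setIntegral_ball_inter_eq e hΛ hC hD h hR, ← integral_smul]
    simp only [mul_smul]
  · refine tendsto_integral_filter_of_dominated_convergence (fun s => ‖Λ s‖) ?_ ?_
      (hΛ.integrable_of_hasCompactSupport hs).norm ?_
    · refine Eventually.of_forall fun R => Measurable.aestronglyMeasurable ?_
      have h1 : Measurable fun ρ => coneVol C ρ :=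
        Monotone.measurable fun ρ ρ' hρ => coneVol_mono subset_rfl hρ
      have h2 : Measurable fun s : ℝ => coneVol C (√(R ^ 2 - s ^ 2)) := h1.comp (by fun_prop)
      exact (h2.const_mul _).smul hΛ.measurable
    · filter_upwards [eventually_gt_atTop 0] with R hR
      refine Eventually.of_forall fun s => ?_
      rw [norm_smul, Real.norm_of_nonneg
        (mul_nonneg (inv_nonneg.2 (kappa_pos hR).le) (coneVol_nonneg _ _))]
      refine mul_le_of_le_one_left (norm_nonneg _) ?_
      rw [inv_mul_le_one₀ (kappa_pos hR), ← coneVol_univ]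
      refine coneVol_mono (Set.subset_univ _) ?_
      rw [Real.sqrt_le_left hR.le]
      nlinarith [sq_nonneg s]
    · refine Eventually.of_forall fun s => Tendsto.smul_const ?_ _
      have h1 := ((tendsto_sqrt_sub_div s).pow m).mul_const (coneVol C 1 / kappa m 1)
      rw [one_pow, one_mul] at h1
      refine h1.congr' ?_
      filter_upwards [eventually_gt_atTop |s|] with R hR
      have hR0 : 0 < R := (abs_nonneg s).trans_lt hR
      have h2 : 0 < √(R ^ 2 - s ^ 2) := by
        rw [Real.sqrt_pos, sub_pos]
        exact sq_lt_sq.2 (by rwa [abs_of_pos hR0])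
      rw [coneVol_eq hcone h2, ← coneVol_univ R,
        coneVol_eq (C := Set.univ) (fun _ _ _ _ => Set.mem_univ _) hR0, coneVol_univ, div_pow]
      have h3 := kappa_pos (m := m) one_pos
      field_simp

end Average

/-! ### The surface integral as an integral over fibers -/

variable {m : ℕ} {e : OrthonormalBasis (Fin (m + 1)) ℂ (Cn (m + 1))}

theorem pairwise_disjoint_imHyperplane {c : ℝ} (hc : 0 < c) (a : ℂ) (K : Set ℤ) :
    K.Pairwise (Function.onFun Disjoint fun k => imHyperplane e (zeroPt c a k).im) := by
  intro k _ l _ hkl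
  refine Set.disjoint_left.2 fun z hz hz' => hkl ?_
  have h1 : (zeroPt c a k).im = (zeroPt c a l).im := Eq.trans (Eq.symm hz) hz'
  rw [zeroPt_im, zeroPt_im, div_left_inj' hc.ne', add_right_inj,
    mul_right_inj' Real.two_pi_pos.ne'] at h1
  exact_mod_cast h1

/-- Off the finitely many hyperplanes indexed by `K` the function vanishes, so the infinite union
reduces to a finite disjoint one. -/
theorem integrableOn_and_setIntegral_iUnion_imHyperplane {h : Cn (m + 1) → ℂ} (hc : Continuous h)
    (hs : HasCompactSupport h) {c : ℝ} (hc0 : 0 < c) (a : ℂ) (K : Finset ℤ)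
    (hK : ∀ k ∉ K, ∀ w v, w.im = (zeroPt c a k).im → h (adapt e w v) = 0) :
    IntegrableOn h (⋃ k : ℤ, imHyperplane e (zeroPt c a k).im)
      (Measure.euclideanHausdorffMeasure (2 * m + 1)) ∧
    ∫ z in ⋃ k : ℤ, imHyperplane e (zeroPt c a k).im, h z
      ∂(Measure.euclideanHausdorffMeasure (2 * m + 1)) =
      ∑ k ∈ K, ∫ x : ℝ, fiberIntegral e h (x + (zeroPt c a k).im * Complex.I) := by
  have hsub : (⋃ k ∈ K, imHyperplane e (zeroPt c a k).im) ⊆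
      ⋃ k : ℤ, imHyperplane e (zeroPt c a k).im :=
    Set.iUnion₂_subset fun k _ => Set.subset_iUnion (fun k => imHyperplane e (zeroPt c a k).im) k
  have hms : MeasurableSet (⋃ k : ℤ, imHyperplane e (zeroPt c a k).im) :=
    MeasurableSet.iUnion fun k => measurableSet_imHyperplane _
  have hzero : ∀ z ∈ (⋃ k : ℤ, imHyperplane e (zeroPt c a k).im) \
      (⋃ k ∈ K, imHyperplane e (zeroPt c a k).im), h z = 0 := by
    rintro z ⟨hz, hz'⟩
    obtain ⟨k, hk⟩ := Set.mem_iUnion.1 hz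
    obtain ⟨v, hv⟩ := exists_eq_adapt e z
    rw [hv]
    refine hK k (fun hkK => hz' ?_) _ v hk
    exact Set.mem_biUnion (s := (K : Set ℤ)) hkK hk
  have hi : ∀ k ∈ K, IntegrableOn h (imHyperplane e (zeroPt c a k).im)
      (Measure.euclideanHausdorffMeasure (2 * m + 1)) := fun k _ =>
    integrableOn_imHyperplane hc hs _
  refine ⟨((integrableOn_finset_iUnion).2 hi).of_forall_sdiff_eq_zero hms hzero, ?_⟩
  rw [setIntegral_eq_of_subset_of_forall_sdiff_eq_zero hms hsub hzero,
    integral_biUnion_finset K (fun k _ => measurableSet_imHyperplane _)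
      (pairwise_disjoint_imHyperplane hc0 a _) hi]
  exact Finset.sum_congr rfl fun k _ => setIntegral_imHyperplane hc hs _

end

end Coamoeba

namespace Coamoeba

noncomputable section

/-! ### Exponential polynomials with a one-dimensional Newton polytope -/

section OneVariableForm

variable {n : ℕ}

/-- `intPt` as a homomorphism. -/
def intPtHom (n : ℕ) : (Fin n → ℤ) →+ Rn n where
  toFun := intPt
  map_zero' := by ext j; simp [intPt]
  map_add' α β := by ext j; simp [intPt]

theorem intPt_injective : Function.Injective (intPt : (Fin n → ℤ) → Rn n) := by
  intro α β h
  ext j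
  have := congrArg (fun x : Rn n => x j) h
  simpa [intPt] using this

/-- The integer points of a real line form a cyclic group. -/
theorem exists_generator_of_finrank_eq_one {V : Submodule ℝ (Rn n)}
    (hV : Module.finrank ℝ V = 1) :
    ∃ β : Fin n → ℤ, ∀ γ : Fin n → ℤ, intPt γ ∈ V → ∃ k : ℤ, k • β = γ := by
  obtain ⟨v, hv, hspan⟩ := finrank_eq_one_iff'.1 hV
  obtain ⟨j, hj⟩ : ∃ j, (v : Rn n) j ≠ 0 := by
    by_contra hcon
    push Not at hcon
    exact hv (Subtype.ext (PiLp.ext hcon))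
  -- A coordinate in which the line is not constant embeds its group of integer points into `ℤ`.
  let M : AddSubgroup (Fin n → ℤ) := V.toAddSubgroup.comap (intPtHom n)
  let f : M →+ ℤ := (Pi.evalAddMonoidHom (fun _ : Fin n => ℤ) j).comp M.subtype
  have hf : Function.Injective f := by
    rw [injective_iff_map_eq_zero]
    intro γ hγ
    obtain ⟨t, ht⟩ := hspan ⟨intPt γ.1, γ.2⟩
    have ht' : t • (v : Rn n) = intPt γ.1 := congrArg Subtype.val ht
    have h1 : t * (v : Rn n) j = (γ.1 j : ℝ) := congrArg (fun x : Rn n => x j) ht'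
    have hγ' : γ.1 j = 0 := hγ
    rw [hγ', Int.cast_zero, mul_eq_zero, or_iff_left hj] at h1
    rw [h1, zero_smul] at ht'
    exact Subtype.ext (intPt_injective (ht'.symm.trans (map_zero (intPtHom n)).symm))
  have hcyc : IsAddCyclic M := isAddCyclic_of_injective f hf
  obtain ⟨β, hβ⟩ := hcyc.exists_generator
  refine ⟨β.1, fun γ hγ => ?_⟩
  obtain ⟨k, hk⟩ := AddSubgroup.mem_zmultiples_iff.1 (hβ ⟨γ, hγ⟩)
  exact ⟨k, congrArg Subtype.val hk⟩

theorem add_zsmul_injective {α β : Fin n → ℤ} (hβ : β ≠ 0) :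
    Function.Injective fun k : ℕ => α + (k : ℤ) • β := by
  intro k l h
  have h1 : (k : ℤ) • β = (l : ℤ) • β := add_left_cancel h
  exact_mod_cast smul_left_injective ℤ hβ h1

/-- Differences of exponents are integer points of the direction line of the polytope, hence
multiples of one `β`, which is nonzero because there are at least two exponents. Taking the extreme
exponent on the `β` side as `α₀` makes all multiples nonnegative and `P(0) ≠ 0`. -/
theorem exists_isOneVariableForm {c : (Fin n → ℤ) →₀ ℂ} (hdim : newtonDim c = 1) :
    ∃ (α₀ β : Fin n → ℤ) (P : ℂ[X]), IsOneVariableForm c α₀ β P := by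
  classical
  obtain ⟨β, hβ⟩ := exists_generator_of_finrank_eq_one hdim
  have hdiff : ∀ α ∈ c.support, ∀ α' ∈ c.support, ∃ k : ℤ, k • β = α - α' := by
    intro α hα α' hα'
    refine hβ _ ?_
    rw [show intPt (α - α') = intPt α - intPt α' from map_sub (intPtHom n) α α']
    exact vsub_mem_vectorSpan ℝ (subset_convexHull ℝ _ ⟨α, hα, rfl⟩)
      (subset_convexHull ℝ _ ⟨α', hα', rfl⟩)
  have hnsub : ¬ (c.support : Set (Fin n → ℤ)).Subsingleton := by
    intro hsub
    have h1 : (newtonPolytope c).Subsingleton := by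
      rcases (hsub.image intPt).eq_empty_or_singleton with h | ⟨x, h⟩
      · simp [newtonPolytope, h]
      · simp [newtonPolytope, h]
    rw [newtonDim, vectorSpan_of_subsingleton ℝ h1] at hdim
    simp at hdim
  have hβ0 : β ≠ 0 := by
    rintro rfl
    refine hnsub fun α hα α' hα' => ?_
    obtain ⟨k, hk⟩ := hdiff α hα α' hα'
    rw [smul_zero] at hk
    exact (sub_eq_zero.1 hk.symm)
  have hne : c.support.Nonempty := by
    by_contra h
    rw [Finset.not_nonempty_iff_eq_empty] at h
    exact hnsub (by simp [h])
  obtain ⟨α₁, hα₁⟩ := hne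
  choose! N hN using fun α hα => hdiff α hα α₁ hα₁
  obtain ⟨α₀, hα₀, hmin⟩ := c.support.exists_min_image N ⟨α₁, hα₁⟩
  have hform : ∀ α ∈ c.support, ∃ k : ℕ, α₀ + (k : ℤ) • β = α := by
    intro α hα
    refine ⟨(N α - N α₀).toNat, ?_⟩
    rw [Int.toNat_of_nonneg (sub_nonneg.2 (hmin α hα)), sub_smul, hN α hα, hN α₀ hα₀]
    abel
  have hinj := add_zsmul_injective (α := α₀) hβ0
  let T : Finset ℕ := c.support.preimage (fun k : ℕ => α₀ + (k : ℤ) • β) hinj.injOn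
  let P : ℂ[X] := ∑ k ∈ T, Polynomial.monomial k (c (α₀ + (k : ℤ) • β))
  have hP : ∀ k : ℕ, P.coeff k = c (α₀ + (k : ℤ) • β) := by
    intro k
    simp only [P, Polynomial.finsetSum_coeff, Polynomial.coeff_monomial]
    rw [Finset.sum_ite_eq' T k]
    split_ifs with h
    · rfl
    · rw [Finset.mem_preimage, Finsupp.mem_support_iff, not_not] at h
      exact h.symm
  refine ⟨α₀, β, P, hβ0, ?_, ?_, hP⟩
  · rw [hP]
    simpa using hα₀
  · ext α
    rw [Finset.mem_image]
    constructor
    · intro hα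
      obtain ⟨k, hk⟩ := hform α hα
      refine ⟨k, ?_, hk⟩
      rw [Polynomial.mem_support_iff, hP, hk]
      exact Finsupp.mem_support_iff.1 hα
    · rintro ⟨k, hk, rfl⟩
      rw [Polynomial.mem_support_iff, hP] at hk
      exact Finsupp.mem_support_iff.2 hk

theorem dotC_add_zsmul (α β : Fin n → ℤ) (k : ℕ) (z : Cn n) :
    dotC (α + (k : ℤ) • β) z = dotC α z + k * dotC β z := by
  simp only [dotC, Pi.add_apply, Pi.smul_apply, smul_eq_mul, Finset.mul_sum,
    ← Finset.sum_add_distrib]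
  refine Finset.sum_congr rfl fun j _ => ?_
  push_cast
  ring

theorem IsOneVariableForm.expPoly_eq {c : (Fin n → ℤ) →₀ ℂ} {α₀ β : Fin n → ℤ} {P : ℂ[X]}
    (h : IsOneVariableForm c α₀ β P) (z : Cn n) :
    expPoly c z = Complex.exp (dotC α₀ z) * P.eval (Complex.exp (dotC β z)) := by
  rw [expPoly, h.support_eq, Finset.sum_image (add_zsmul_injective h.beta_ne_zero).injOn,
    Polynomial.eval_eq_sum, Polynomial.sum, Finset.mul_sum]
  refine Finset.sum_congr rfl fun k _ => ?_
  rw [← h.coeff_eq, dotC_add_zsmul, Complex.exp_add, Complex.exp_nat_mul]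
  ring

end OneVariableForm

/-! ### The unit vector in the direction of `β` -/

theorem exists_orthonormalBasis_zero {𝕜 : Type*} [RCLike 𝕜] {m : ℕ}
    {b : EuclideanSpace 𝕜 (Fin (m + 1))} (hb : ‖b‖ = 1) :
    ∃ e : OrthonormalBasis (Fin (m + 1)) 𝕜 (EuclideanSpace 𝕜 (Fin (m + 1))), e 0 = b := by
  have hv : Orthonormal 𝕜 (({0} : Set (Fin (m + 1))).domRestrict fun _ => b) := by
    refine ⟨fun _ => hb, fun i j hij => (hij (Subsingleton.elim i j)).elim⟩
  obtain ⟨e, he⟩ := hv.exists_orthonormalBasis_extension_of_card_eq (by simp)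
  exact ⟨e, he 0 rfl⟩

section UnitVector

variable {n : ℕ}

/-- The conjugation in the Hermitian product disappears for a real vector, so the coordinate along
`β/|β|` is the holomorphic function `β·z/|β|`. -/
theorem inner_realPt (x : Rn n) (z : Cn n) : inner ℂ (realPt x) z = ∑ j, (x j : ℂ) * z j := by
  simp [PiLp.inner_apply, realPt, mul_comm]

theorem inner_realPt_realPt (x y : Rn n) :
    inner ℂ (realPt x) (realPt y) = ((inner ℝ x y : ℝ) : ℂ) := by
  rw [inner_realPt]
  simp [PiLp.inner_apply, realPt, mul_comm]

theorem norm_realPt (x : Rn n) : ‖realPt x‖ = ‖x‖ := by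
  simp [EuclideanSpace.norm_eq, realPt]

theorem re_inner_realPt (x : Rn n) (z : Cn n) :
    (inner ℂ (realPt x) z).re = inner ℝ x (rePart z) := by
  rw [inner_realPt]
  simp [PiLp.inner_apply, rePart, mul_comm]

/-- The unit vector in the direction of an integer vector. -/
def unitVec (β : Fin n → ℤ) : Rn n := ‖intPt β‖⁻¹ • intPt β

theorem norm_intPt_pos {β : Fin n → ℤ} (hβ : β ≠ 0) : 0 < ‖intPt β‖ := by
  rw [norm_pos_iff]
  intro h
  exact hβ (intPt_injective (h.trans (map_zero (intPtHom n)).symm))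

theorem norm_unitVec {β : Fin n → ℤ} (hβ : β ≠ 0) : ‖unitVec β‖ = 1 := by
  rw [unitVec, norm_smul, norm_inv, norm_norm, inv_mul_cancel₀ (norm_intPt_pos hβ).ne']

theorem inner_realPt_unitVec (β : Fin n → ℤ) (z : Cn n) :
    inner ℂ (realPt (unitVec β)) z = ‖intPt β‖⁻¹ • dotC β z := by
  rw [inner_realPt, dotC, Finset.smul_sum]
  refine Finset.sum_congr rfl fun j _ => ?_
  simp [unitVec, intPt, mul_assoc]

theorem unitDx_apply (β : Fin n → ℤ) (z : Cn n) :
    unitDx β z = (inner ℂ (realPt (unitVec β)) z).re := by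
  rw [inner_realPt_unitVec]
  simp [unitDx, dotC]

theorem unitDy_apply (β : Fin n → ℤ) (z : Cn n) :
    unitDy β z = (inner ℂ (realPt (unitVec β)) z).im := by
  rw [inner_realPt_unitVec]
  simp [unitDy, dotC]

theorem smul_inner_realPt_unitVec {β : Fin n → ℤ} (hβ : β ≠ 0) (z : Cn n) :
    ‖intPt β‖ • inner ℂ (realPt (unitVec β)) z = dotC β z := by
  rw [inner_realPt_unitVec, smul_inv_smul₀ (norm_intPt_pos hβ).ne']

/-- The real part of `α · z` as a continuous linear function. -/
def reDot (α : Fin n → ℤ) : Cn n →L[ℝ] ℝ := ∑ j, (α j : ℝ) •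
    Complex.reCLM.comp ((EuclideanSpace.proj j : Cn n →L[ℂ] ℂ).restrictScalars ℝ)

theorem reDot_apply (α : Fin n → ℤ) (z : Cn n) : reDot α z = (dotC α z).re := by
  simp [reDot, dotC]

end UnitVector

end

end Coamoeba

namespace Coamoeba

noncomputable section

/-! ### The profile of the averaged currents -/

variable {m : ℕ}

/-- The value of the Lelong current on the translate of a test form with transverse coefficient `h`
by a vector with coordinate `s` along `e₀`. -/
def profile (e : OrthonormalBasis (Fin (m + 1)) ℂ (Cn (m + 1))) (h : Cn (m + 1) → ℂ) (P : ℂ[X])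
    (c : ℝ) (K : Finset ℤ) (s : ℝ) : ℂ :=
  ∑ a ∈ P.roots.toFinset, (P.rootMultiplicity a : ℂ) *
    ∑ k ∈ K, fiberIntegral e h (zeroPt c a k - s)

section Profile

variable {e : OrthonormalBasis (Fin (m + 1)) ℂ (Cn (m + 1))} {h : Cn (m + 1) → ℂ} {P : ℂ[X]}
  {c : ℝ} {K : Finset ℤ}

theorem continuous_profile (hc : Continuous h) (hs : HasCompactSupport h) :
    Continuous (profile e h P c K) := by
  have := continuous_fiberIntegral (e := e) hc hs
  unfold profile
  fun_prop

theorem hasCompactSupport_finsetSum {ι X : Type*} [TopologicalSpace X] (s : Finset ι)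
    {φ : ι → X → ℂ} (h : ∀ i, HasCompactSupport (φ i)) :
    HasCompactSupport fun x => ∑ i ∈ s, φ i x := by
  classical
  induction s using Finset.induction_on with
  | empty => simpa using! HasCompactSupport.zero
  | insert i s hi ih => simpa [Finset.sum_insert hi] using! (h i).add ih

theorem hasCompactSupport_fiberIntegral_sub (hs : HasCompactSupport h) (p : ℂ) :
    HasCompactSupport fun s : ℝ => fiberIntegral e h (p - s) := by
  have h1 : Isometry fun s : ℝ => p - (s : ℂ) := Isometry.of_dist_eq fun x y => by
    rw [dist_sub_left, Complex.dist_eq, ← Complex.ofReal_sub, Complex.norm_real]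
    rfl
  exact (hasCompactSupport_fiberIntegral hs).comp_isClosedEmbedding h1.isClosedEmbedding

theorem hasCompactSupport_profile (hs : HasCompactSupport h) :
    HasCompactSupport (profile e h P c K) :=
  hasCompactSupport_finsetSum _ fun _ => (hasCompactSupport_finsetSum _ fun _ =>
    hasCompactSupport_fiberIntegral_sub hs _).mul_left

/-- As `s` runs over `ℝ`, the point `zeroPt c a k - s` runs over the horizontal line through the
zero: the complex hyperplanes sweep out the real ones. -/
theorem integral_profile (hc : Continuous h) (hs : HasCompactSupport h) :
    ∫ s, profile e h P c K s = ∑ a ∈ P.roots.toFinset, (P.rootMultiplicity a : ℂ) *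
      ∑ k ∈ K, ∫ x : ℝ, fiberIntegral e h (x + (zeroPt c a k).im * Complex.I) := by
  have hi : ∀ p : ℂ, Integrable fun s : ℝ => fiberIntegral e h (p - s) := fun p =>
    Continuous.integrable_of_hasCompactSupport
      ((continuous_fiberIntegral hc hs).comp (by fun_prop))
      (hasCompactSupport_fiberIntegral_sub hs p)
  unfold profile
  rw [integral_finsetSum _ fun a _ => (integrable_finsetSum _ fun k _ => hi _).const_mul _]
  refine Finset.sum_congr rfl fun a _ => ?_
  rw [integral_const_mul, integral_finsetSum _ fun k _ => hi _]
  congr 1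
  refine Finset.sum_congr rfl fun k _ => ?_
  rw [← integral_sub_left_eq_self (fun x : ℝ =>
    fiberIntegral e h (x + (zeroPt c a k).im * Complex.I)) volume (zeroPt c a k).re]
  refine integral_congr_ae (Eventually.of_forall fun s => ?_)
  dsimp only
  congr 1
  conv_lhs => rw [← Complex.re_add_im (zeroPt c a k)]
  push_cast
  ring

theorem exists_ne_zero_of_profile_ne_zero {s : ℝ} (hs : profile e h P c K s ≠ 0) :
    ∃ a ∈ P.roots, ∃ k v, h (adapt e (zeroPt c a k - s) v) ≠ 0 := by
  obtain ⟨a, ha, h1⟩ := Finset.exists_ne_zero_of_sum_ne_zero hs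
  obtain ⟨k, -, h2⟩ := Finset.exists_ne_zero_of_sum_ne_zero (right_ne_zero_of_mul h1)
  exact ⟨a, Multiset.mem_toFinset.1 ha, k, exists_ne_zero_of_fiberIntegral_ne_zero h2⟩

end Profile

/-! ### The Lelong and shell pairings in terms of the profile -/

section Form

variable {c : (Fin (m + 1) → ℤ) →₀ ℂ} {α₀ β : Fin (m + 1) → ℤ} {P : ℂ[X]}
  {ξ : Cn (m + 1) → AltForm (m + 1) (2 * m)}
  {e : OrthonormalBasis (Fin (m + 1)) ℂ (Cn (m + 1))}

theorem IsOneVariableForm.isOneVariable (h : IsOneVariableForm c α₀ β P)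
    (he : e 0 = realPt (unitVec β)) :
    IsOneVariable e (expPoly c) P ‖intPt β‖ (reDot α₀) where
  pos := norm_intPt_pos h.beta_ne_zero
  coeff_zero_ne_zero := h.coeff_zero_ne_zero
  norm_eq z := by
    rw [h.expPoly_eq, norm_mul, Complex.norm_exp, reDot_apply, he,
      smul_inner_realPt_unitVec h.beta_ne_zero]

theorem surfaceDensity_wedgeDx (he : e 0 = realPt (unitVec β)) :
    surfaceDensity β (wedgeDx β ξ) = transCoeff e ξ := by
  ext z
  rw [surfaceDensity, wedgeDx, topCoeff_eq_apply_frame e]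
  exact wedgeOne_frame_eq_transCoeff e (ξ z) (unitDx β) (unitDy β)
    (fun z => by rw [he, unitDx_apply]) (fun z => by rw [he, unitDy_apply])

theorem argHypersurface_eq_iUnion (hβ : β ≠ 0) (he : e 0 = realPt (unitVec β)) (a : ℂ) :
    argHypersurface β a = ⋃ k : ℤ, imHyperplane e (zeroPt ‖intPt β‖ a k).im := by
  ext z
  rw [Set.mem_iUnion]
  refine exists_congr fun k => ?_
  have h1 : ∑ j, (β j : ℝ) * (z j).im = (dotC β z).im := by simp [dotC]
  have hpos := norm_intPt_pos hβ
  rw [h1, ← smul_inner_realPt_unitVec hβ, Complex.smul_im, smul_eq_mul, imHyperplane,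
    Set.mem_ofPred_eq, he, zeroPt_im, eq_div_iff hpos.ne', mul_comm]

/-- For real `r` the coordinate along `e₀` shifts by a real number. Imaginary parts are unchanged,
so `K` does not depend on `r`. -/
theorem lelong_translate (h : IsOneVariableForm c α₀ β P) (he : e 0 = realPt (unitVec β))
    (hξ : IsTestForm ξ) {K : Finset ℤ}
    (hK : ∀ a : ℂ, ∀ k ∉ K, ∀ w v, w.im = (zeroPt ‖intPt β‖ a k).im →
      transCoeff e ξ (adapt e w v) = 0) (r : Rn (m + 1)) :
    lelong (expPoly c) (translate ξ r) =
      profile e (transCoeff e ξ) P ‖intPt β‖ K (inner ℝ (unitVec β) r) := by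
  have hin : inner ℂ (e 0) (realPt r) = ((inner ℝ (unitVec β) r : ℝ) : ℂ) := by
    rw [he, inner_realPt_realPt]
  rw [(h.isOneVariable he).lelong_eq (hξ.translate r) K, profile]
  · simp only [fiberIntegral_translate, hin]
  · intro a _ k hk v
    obtain ⟨v₀, hv₀⟩ := exists_eq_adapt e (realPt r)
    rw [transCoeff_translate, hv₀, ← adapt_sub]
    refine hK a k hk _ _ ?_
    rw [hin, Complex.sub_im, Complex.ofReal_im, sub_zero]

theorem shellPairing_eq (h : IsOneVariableForm c α₀ β P) (he : e 0 = realPt (unitVec β))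
    (hξ : IsTestForm ξ) {K : Finset ℤ}
    (hK : ∀ a : ℂ, ∀ k ∉ K, ∀ w v, w.im = (zeroPt ‖intPt β‖ a k).im →
      transCoeff e ξ (adapt e w v) = 0) :
    shellPairing β P ξ = ∫ s, profile e (transCoeff e ξ) P ‖intPt β‖ K s := by
  have hT := hξ.isTest_transCoeff e
  rw [integral_profile hT.continuous hT.compact, shellPairing]
  refine Finset.sum_congr rfl fun a _ => ?_
  rw [surfaceIntegral, surfaceDensity_wedgeDx he, argHypersurface_eq_iUnion h.beta_ne_zero he,
    (integrableOn_and_setIntegral_iUnion_imHyperplane hT.continuous hT.compact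
      (norm_intPt_pos h.beta_ne_zero) a K (hK a)).2]

/-- If the profile is nonzero at `s`, the support of `ξ` contains a point whose real part has
coordinate `log|a|/|β| - s` along `β/|β|`, and this is less than `S` in absolute value. -/
theorem abs_lt_of_profile_ne_zero (hβ : β ≠ 0) (he : e 0 = realPt (unitVec β)) {K : Finset ℤ}
    {S M : ℝ} (hS : ∀ z ∈ tsupport ξ, rePart z ∈ Metric.ball (0 : Rn (m + 1)) S)
    (hM : ∀ a ∈ P.roots, |Real.log ‖a‖| / ‖intPt β‖ + S < M) {s : ℝ}
    (hs : profile e (transCoeff e ξ) P ‖intPt β‖ K s ≠ 0) : |s| < M := by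
  obtain ⟨a, ha, k, v, hne⟩ := exists_ne_zero_of_profile_ne_zero hs
  refine lt_of_le_of_lt ?_ (hM a ha)
  set z := adapt e (zeroPt ‖intPt β‖ a k - s) v
  have hz : z ∈ tsupport ξ := subset_tsupport _ fun h0 => hne (by rw [transCoeff, h0]; rfl)
  have h1 := hS z hz
  rw [mem_ball_zero_iff] at h1
  have h2 : (inner ℂ (e 0) z).re = Real.log ‖a‖ / ‖intPt β‖ - s := by
    rw [inner_adapt, Complex.sub_re, zeroPt_re, Complex.ofReal_re]
  rw [he, re_inner_realPt] at h2
  have h3 := abs_real_inner_le_norm (unitVec β) (rePart z)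
  rw [norm_unitVec hβ, one_mul, h2] at h3
  have h4 : |Real.log ‖a‖| / ‖intPt β‖ = |Real.log ‖a‖ / ‖intPt β‖| := by
    rw [abs_div, abs_norm]
  rw [h4]
  have h5 := abs_sub_abs_le_abs_sub s (Real.log ‖a‖ / ‖intPt β‖)
  rw [abs_sub_comm] at h5
  linarith

end Form

/-! ### Cones and slabs -/

section Cone

variable {β : Fin (m + 1) → ℤ} {e : OrthonormalBasis (Fin (m + 1)) ℝ (Rn (m + 1))}
  {C : Set (Rn (m + 1))}

theorem inner_intPt_eq (hβ : β ≠ 0) (he : e 0 = unitVec β) (x : Rn (m + 1)) :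
    inner ℝ x (intPt β) = ‖intPt β‖ * inner ℝ (e 0) x := by
  rw [he, unitVec, inner_smul_left, real_inner_comm]
  simp [mul_inv_cancel_left₀ (norm_intPt_pos hβ).ne']

theorem IsConeIn.exists_eq_adapt_zero (hβ : β ≠ 0) (he : e 0 = unitVec β) (hC : IsConeIn β C)
    {x : Rn (m + 1)} (hx : x ∈ C) : ∃ t, x = adapt e 0 t := by
  obtain ⟨t, ht⟩ := exists_eq_adapt e x
  have h1 := hC.perp x hx
  rw [inner_intPt_eq hβ he, mul_eq_zero, or_iff_right (norm_intPt_pos hβ).ne'] at h1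
  exact ⟨t, by rw [h1] at ht; exact ht⟩

theorem adapt_mem_segmentL_add_iff (hβ : β ≠ 0) (he : e 0 = unitVec β) (hC : IsConeIn β C) {M s : ℝ}
    {t : Rn m} : adapt e s t ∈ segmentL β M + C ↔ |s| ≤ M ∧ adapt e 0 t ∈ C := by
  have hpos := norm_intPt_pos hβ
  have hint : intPt β = adapt e ‖intPt β‖ 0 := by
    simp [adapt, he, unitVec, smul_smul, mul_inv_cancel₀ hpos.ne']
  have hseg : ∀ y : ℝ, y • intPt β = adapt e (y * ‖intPt β‖) 0 := fun y => by
    conv_lhs => rw [hint, ← adapt_smul, smul_zero]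
  constructor
  · rintro ⟨_, ⟨y, hy, rfl⟩, x, hx, hsum⟩
    obtain ⟨t', rfl⟩ := hC.exists_eq_adapt_zero hβ he hx
    dsimp only at hsum
    rw [hseg, ← adapt_add, add_zero, zero_add, ← adaptHomeo_apply e (y * ‖intPt β‖, t'),
      ← adaptHomeo_apply e (s, t)] at hsum
    have h1 := (adaptHomeo e).injective hsum
    rw [Prod.mk.injEq] at h1
    obtain ⟨rfl, rfl⟩ := h1
    refine ⟨?_, hx⟩
    rw [abs_mul, abs_norm, ← le_div_iff₀ hpos, abs_le]
    exact hy
  · rintro ⟨hs, ht⟩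
    refine ⟨(s / ‖intPt β‖) • intPt β, ⟨s / ‖intPt β‖, ?_, rfl⟩, adapt e 0 t, ht, ?_⟩
    · rw [Set.mem_Icc, ← abs_le, abs_div, abs_norm]
      gcongr
    · dsimp only
      rw [hseg, ← adapt_add, add_zero, zero_add, div_mul_cancel₀ _ hpos.ne']

theorem isometry_adapt_zero : Isometry fun t : Rn m => adapt e 0 t :=
  Isometry.of_dist_eq fun x y => by
    rw [dist_eq_norm, ← adapt_sub, ← sq_eq_sq₀ (norm_nonneg _) dist_nonneg, norm_adapt_sq,
      dist_eq_norm]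
    simp

theorem vol_cone_inter_ball (hβ : β ≠ 0) (he : e 0 = unitVec β) (hC : IsConeIn β C) :
    vol m (C ∩ Metric.ball 0 1) = coneVol ((fun t : Rn m => adapt e 0 t) ⁻¹' C) 1 := by
  have h1 : C ∩ Metric.ball 0 1 = (fun t : Rn m => adapt e 0 t) ''
      ((fun t : Rn m => adapt e 0 t) ⁻¹' C ∩ Metric.ball 0 1) := by
    have hn : ∀ t : Rn m, ‖adapt e 0 t‖ = ‖t‖ := fun t => by
      rw [← sq_eq_sq₀ (norm_nonneg _) (norm_nonneg _), norm_adapt_sq]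
      simp
    ext x
    constructor
    · rintro ⟨hx, hx1⟩
      obtain ⟨t, rfl⟩ := hC.exists_eq_adapt_zero hβ he hx
      rw [mem_ball_zero_iff, hn] at hx1
      exact ⟨t, ⟨hx, mem_ball_zero_iff.2 hx1⟩, rfl⟩
    · rintro ⟨t, ⟨ht, ht1⟩, rfl⟩
      refine ⟨ht, ?_⟩
      rw [mem_ball_zero_iff] at ht1 ⊢
      rwa [hn]
  rw [vol, measureReal_def, h1, isometry_adapt_zero.euclideanHausdorffMeasure_image,
    EuclideanSpace.euclideanHausdorffMeasure_eq_volume]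
  rfl

/-- The summands are orthogonal, so in adapted coordinates the Minkowski sum is a product. -/
theorem measurableSet_segmentL_add (hβ : β ≠ 0) (he : e 0 = unitVec β) (hC : IsConeIn β C) (M : ℝ) :
    MeasurableSet (segmentL β M + C) := by
  have h1 : segmentL β M + C = (adaptHomeo e).symm ⁻¹'
      (Set.Icc (-M) M ×ˢ ((fun t : Rn m => adapt e 0 t) ⁻¹' C)) := by
    ext x
    obtain ⟨⟨s, t⟩, rfl⟩ := (adaptHomeo e).surjective x
    rw [Set.mem_preimage, Homeomorph.symm_apply_apply, adaptHomeo_apply,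
      adapt_mem_segmentL_add_iff hβ he hC, abs_le]
    rfl
  rw [h1]
  exact (adaptHomeo e).symm.continuous.measurable
    (measurableSet_Icc.prod (isometry_adapt_zero.continuous.measurable hC.measurable))

end Cone

end

end Coamoeba

open Coamoeba in
/-- The dimension is `n = m + 1`; a one-dimensional Newton polytope forces `n ≥ 1`. -/
theorem proposition4p3 (m : ℕ) (c : (Fin (m + 1) → ℤ) →₀ ℂ) (hdim : newtonDim c = 1) :
    -- `f` can be written in the form `e^{α₀·z} P(e^{β·z})`
    (∃ (α₀ β : Fin (m + 1) → ℤ) (P : ℂ[X]), IsOneVariableForm c α₀ β P) ∧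
    ∀ (α₀ β : Fin (m + 1) → ℤ) (P : ℂ[X]), IsOneVariableForm c α₀ β P →
      (∀ z, expPoly c z = Complex.exp (dotC α₀ z) * P.eval (Complex.exp (dotC β z))) ∧
      ∀ ξ : Cn (m + 1) → AltForm (m + 1) (2 * m), IsTestForm ξ →
        -- all the integrals below converge absolutely
        (∀ r, Integrable (lelongDensity (expPoly c) (translate ξ r))) ∧
        (∀ R, IntegrableOn (fun r => lelong (expPoly c) (translate ξ r))
          (Metric.ball (0 : Rn (m + 1)) R)) ∧
        (∀ a ∈ P.roots, IntegrableOn (surfaceDensity β (wedgeDx β ξ)) (argHypersurface β a)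
          (Measure.euclideanHausdorffMeasure (2 * m + 1))) ∧
        -- the averages over balls converge
        Tendsto (average (expPoly c) ξ Set.univ) atTop (𝓝 (shellPairing β P ξ)) ∧
        -- the averages over the part of the ball in the Minkowski sum of a segment and a cone
        ∀ S : ℝ, (∀ z ∈ tsupport ξ, rePart z ∈ Metric.ball (0 : Rn (m + 1)) S) →
          ∀ C : Set (Rn (m + 1)), IsConeIn β C →
            ∀ M : ℝ, (∀ a ∈ P.roots, |Real.log ‖a‖| / ‖intPt β‖ + S < M) →
              Tendsto (average (expPoly c) ξ (segmentL β M + C)) atTop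
                (𝓝 (((vol m (C ∩ Metric.ball 0 1) / kappa m 1 : ℝ) : ℂ) *
                  shellPairing β P ξ)) := by
  refine ⟨exists_isOneVariableForm hdim, fun α₀ β P h => ⟨h.expPoly_eq, fun ξ hξ => ?_⟩⟩
  have hβ := h.beta_ne_zero
  -- A complex basis for `z` and a real one for `r`; only their common first vector `β/|β|` matters.
  obtain ⟨e, he⟩ := exists_orthonormalBasis_zero (𝕜 := ℂ) (b := realPt (unitVec β))
    (by rw [norm_realPt, norm_unitVec hβ])
  obtain ⟨e', he'⟩ := exists_orthonormalBasis_zero (𝕜 := ℝ) (norm_unitVec hβ)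
  have hT := hξ.isTest_transCoeff e
  obtain ⟨K, hK⟩ := exists_finset_zeroPt (e := e) hT.compact (norm_intPt_pos hβ)
  let Λ := profile e (transCoeff e ξ) P ‖intPt β‖ K
  have hΛ : Continuous Λ := continuous_profile hT.continuous hT.compact
  have hΛs : HasCompactSupport Λ := hasCompactSupport_profile hT.compact
  have hlelong : ∀ r, lelong (expPoly c) (translate ξ r) = Λ (inner ℝ (e' 0) r) := fun r => by
    rw [he']; exact lelong_translate h he hξ hK r
  have hshell : shellPairing β P ξ = ∫ s, Λ s := shellPairing_eq h he hξ hK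
  have havg : ∀ D R, average (expPoly c) ξ D R =
      ((kappa m R)⁻¹ : ℝ) • ∫ r in Metric.ball 0 R ∩ D, Λ (inner ℝ (e' 0) r) := fun D R => by
    simp only [Coamoeba.average, hlelong]
  refine ⟨fun r => (h.isOneVariable he).integrable_lelongDensity (hξ.translate r), fun R => ?_,
    fun a _ => ?_, ?_, fun S hS C hC M hM => ?_⟩
  · simp only [hlelong]
    have hcont : Continuous fun r => Λ (inner ℝ (e' 0) r) := hΛ.comp (by fun_prop)
    exact (hcont.continuousOn.integrableOn_compact
      (isCompact_closedBall (0 : Rn (m + 1)) R)).mono_set Metric.ball_subset_closedBall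
  · rw [surfaceDensity_wedgeDx he, argHypersurface_eq_iUnion hβ he]
    exact (integrableOn_and_setIntegral_iUnion_imHyperplane hT.continuous hT.compact
      (norm_intPt_pos hβ) a K (hK a)).1
  -- The full average is the case where the cone is the whole hyperplane and the ratio of volumes is
  -- 1.
  · have := tendsto_setAverage e' hΛ hΛs (C := Set.univ) MeasurableSet.univ
      (fun _ _ _ _ => Set.mem_univ _) (D := Set.univ) MeasurableSet.univ (by simp)
    rw [coneVol_univ, div_self (kappa_pos one_pos).ne', Complex.ofReal_one, one_mul] at this
    rw [hshell]
    exact this.congr fun R => (havg _ R).symm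
  · have := tendsto_setAverage e' hΛ hΛs
      (isometry_adapt_zero.continuous.measurable hC.measurable)
      (fun t ht x hx => by
        have h1 := hC.smul_mem t ht _ hx
        rw [← adapt_smul, mul_zero] at h1
        exact h1)
      (measurableSet_segmentL_add hβ he' hC M)
      -- Where the profile is nonzero, `|s| < M`, so the slab condition holds and only the cone
      -- condition remains.
      (fun s t hs => by
        rw [adapt_mem_segmentL_add_iff hβ he' hC, and_iff_right]
        · rfl
        · exact (abs_lt_of_profile_ne_zero hβ he hS hM hs).le)
    rw [hshell, vol_cone_inter_ball hβ he' hC]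
    exact this.congr fun R => (havg _ R).symm
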